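/- Let $C$ be a category with finite limits and let $\mathcal F=\mathrm{Hom}(C^{\mathrm{op}},\mathrm{Cat})$ be the 2-category of pseudofunctors $C^{\mathrm{op}}\to\mathrm{Cat}$, pseudonatural transformations and modifications; here $\mathrm{Cat}$ is the 2-category of all categories whose hom-sets lie in a fixed universe $\mathcal U_v$ and whose sets of objects lie in a fixed universe $\mathcal U_w\supseteq\mathcal U_v$. A pseudosimplicial object of $\mathcal F$ is a pseudofunctor $E:\Delta^{\mathrm{op}}\to\mathcal F$, with faces $d_r$ and degeneracies $i_r$. For $Y\in\mathcal F$, write $\partial_r$ and $\iota_0$ for precomposition with $d_r$ and $i_0$. The descent category $\mathrm{Desc}_p\,\mathcal F(E,Y)$ has as objects the pairs $(g,\gamma)$ where $g:E_0\to Y$ is a morphism of $\mathcal F$ and $\gamma:\partial_1 g\to\partial_0 g$ is a (not necessarily invertible) 2-cell in $\mathcal F(E_1,Y)$ such that, modulo the coherence isomorphisms of $E$, $\iota_0\gamma=1_g$ and $\partial_1\gamma=\partial_0\gamma\circ\partial_2\gamma$. A morphism $(g,\gamma)\to(g',\gamma')$ is a 2-cell $u:g\to g'$ with $\partial_0u\circ\gamma=\gamma'\circ\partial_1u$.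 A morphism $p:E_0\to B$ exhibits $B$ as the bicategorical codescent object of $E$ when there is a 2-cell $\lambda:p\,d_1\to p\,d_0$ such that $(p,\lambda)$ is an object of $\mathrm{Desc}_p\,\mathcal F(E,B)$ and, for every $Y\in\mathcal F$, the functor $\mathcal F(B,Y)\to\mathrm{Desc}_p\,\mathcal F(E,Y)$, $h\mapsto(hp,h\lambda)$, is an equivalence of categories. **Proposition 5.1.** For every morphism $p:X\to B$ of $\mathcal F$, the following are equivalent: 1. $p$ is pointwise essentially surjective on objects, that is, for every object $U$ of $C$ the functor $p_U:XU\to BU$ is essentially surjective on objects; 2. there is a pseudosimplicial object $E$ of $\mathcal F$ with $E_0=X$ such that $p$ exhibits $B$ as the bicategorical codescent object of $E$. -/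

import Mathlib

open CategoryTheory Bicategory Opposite
open scoped Simplicial CategoryTheory.Pseudofunctor.StrongTrans

universe w₁ v₁ u₁

/-- A pseudosimplicial object of a bicategory `M`: a pseudofunctor `Δᵒᵖ ⥤ M`. -/
abbrev PseudosimplicialObject (M : Type u₁) [Bicategory.{w₁, v₁} M] :=
  LocallyDiscrete SimplexCategoryᵒᵖ ⥤ᵖ M

namespace PseudosimplicialObject

variable {M : Type u₁} [Bicategory.{w₁, v₁} M] (E : PseudosimplicialObject M)

/-- The object `E_n`. -/
abbrev level (n : ℕ) : M := E.obj ⟨op ⦋n⦌⟩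

/-- The face morphism `d_i : E_{n+1} ⟶ E_n`. With the usual conventions
`d_0 : E_1 ⟶ E_0` is "codomain" and `d_1 : E_1 ⟶ E_0` is "domain". -/
abbrev d {n : ℕ} (i : Fin (n + 2)) : E.level (n + 1) ⟶ E.level n :=
  E.map (SimplexCategory.δ i).op.toLoc

/-- The degeneracy morphism `i_0 : E_0 ⟶ E_1`. -/
abbrev i₀ : E.level 0 ⟶ E.level 1 :=
  E.map (SimplexCategory.σ (n := 0) 0).op.toLoc

/-- The structural isomorphism `E(b) ∘ E(a) ≅ E(b') ∘ E(a')` of the pseudofunctor `E`,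
when `a` followed by `b` equals `a'` followed by `b'`. -/
abbrev square {x y y' z : LocallyDiscrete SimplexCategoryᵒᵖ}
    (a : x ⟶ y) (b : y ⟶ z) (a' : x ⟶ y') (b' : y' ⟶ z) (h : a ≫ b = a' ≫ b') :
    E.map a ≫ E.map b ≅ E.map a' ≫ E.map b' :=
  (E.mapComp' a b (a' ≫ b') h).symm ≪≫ E.mapComp a' b'

/-- The isomorphism replacing the simplicial identity `d_1 d_2 = d_1 d_1 : E_2 ⟶ E_0`. -/
abbrev dd₂₁ : E.d (n := 1) 2 ≫ E.d (n := 0) 1 ≅ E.d (n := 1) 1 ≫ E.d (n := 0) 1 :=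
  E.square _ _ _ _ (congrArg (fun f => f.op.toLoc)
    (SimplexCategory.δ_comp_δ (n := 0) (i := 1) (j := 1) le_rfl))

/-- The isomorphism replacing the simplicial identity `d_0 d_2 = d_1 d_0 : E_2 ⟶ E_0`. -/
abbrev dd₂₀ : E.d (n := 1) 2 ≫ E.d (n := 0) 0 ≅ E.d (n := 1) 0 ≫ E.d (n := 0) 1 :=
  E.square _ _ _ _ (congrArg (fun f => f.op.toLoc)
    (SimplexCategory.δ_comp_δ (n := 0) (i := 0) (j := 1) (Fin.zero_le _)))

/-- The isomorphism replacing the simplicial identity `d_0 d_0 = d_0 d_1 : E_2 ⟶ E_0`. -/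
abbrev dd₀₀ : E.d (n := 1) 0 ≫ E.d (n := 0) 0 ≅ E.d (n := 1) 1 ≫ E.d (n := 0) 0 :=
  E.square _ _ _ _ (congrArg (fun f => f.op.toLoc)
    (SimplexCategory.δ_comp_δ (n := 0) (i := 0) (j := 0) le_rfl).symm)

/-- The isomorphism replacing the simplicial identity `d_1 i_0 = 1`. -/
abbrev id₁ : E.i₀ ≫ E.d (n := 0) 1 ≅ 𝟙 (E.level 0) :=
  (E.mapComp' _ _ (𝟙 _) (congrArg (fun f => f.op.toLoc)
    (SimplexCategory.δ_comp_σ_succ (n := 0) (i := 0)))).symm ≪≫ E.mapId _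

/-- The isomorphism replacing the simplicial identity `d_0 i_0 = 1`. -/
abbrev id₀ : E.i₀ ≫ E.d (n := 0) 0 ≅ 𝟙 (E.level 0) :=
  (E.mapComp' _ _ (𝟙 _) (congrArg (fun f => f.op.toLoc)
    (SimplexCategory.δ_comp_σ_self (n := 0) (i := 0)))).symm ≪≫ E.mapId _

/-- An object of the descent category `Desc_p M(E, Y)` of the pseudocosimplicial category
`M(E, Y)`: an object `g` of `M(E_0, Y)` and a (not necessarily invertible) morphism
`γ : ∂_1 g ⟶ ∂_0 g` of `M(E_1, Y)`, where `∂_r` is composition with `d_r`, such that `ι_0 γ` is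
the identity and `∂_1 γ = ∂_0 γ ∘ ∂_2 γ`, modulo the constraint isomorphisms of `E` and `M`. -/
structure DescentDatum (Y : M) where
  g : E.level 0 ⟶ Y
  γ : E.d (n := 0) 1 ≫ g ⟶ E.d (n := 0) 0 ≫ g
  unit : E.i₀ ◁ γ =
    (α_ _ _ _).inv ≫ E.id₁.hom ▷ g ≫ E.id₀.inv ▷ g ≫ (α_ _ _ _).hom
  cocycle :
    E.d (n := 1) 2 ◁ γ ≫ (α_ _ _ _).inv ≫ E.dd₂₀.hom ▷ g ≫ (α_ _ _ _).hom ≫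
        E.d (n := 1) 0 ◁ γ ≫ (α_ _ _ _).inv ≫ E.dd₀₀.hom ▷ g ≫ (α_ _ _ _).hom =
      (α_ _ _ _).inv ≫ E.dd₂₁.hom ▷ g ≫ (α_ _ _ _).hom ≫ E.d (n := 1) 1 ◁ γ

namespace DescentDatum

variable {E} {Y : M}

/-- A morphism `(g, γ) ⟶ (g', γ')` of the descent category: a morphism `u : g ⟶ g'` with
`∂_0 u ∘ γ = γ' ∘ ∂_1 u`. -/
@[ext]
structure Hom (s t : E.DescentDatum Y) where
  u : s.g ⟶ t.g
  comm : s.γ ≫ E.d (n := 0) 0 ◁ u = E.d (n := 0) 1 ◁ u ≫ t.γ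

/-- The descent category `Desc_p M(E, Y)`; composition is that of `M(E_0, Y)`. -/
instance : Category (E.DescentDatum Y) where
  Hom := Hom
  id s := ⟨𝟙 s.g, by simp⟩
  comp f f' := ⟨f.u ≫ f'.u, by
    rw [whiskerLeft_comp, whiskerLeft_comp, ← Category.assoc, f.comm, Category.assoc, f'.comm,
      Category.assoc]⟩
  id_comp f := Hom.ext (Category.id_comp f.u)
  comp_id f := Hom.ext (Category.comp_id f.u)
  assoc f f' f'' := Hom.ext (Category.assoc f.u f'.u f''.u)

/-- Transporting a descent datum on `B` along a morphism `h : B ⟶ Y`. -/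
@[simps]
def push {B : M} (s : E.DescentDatum B) (h : B ⟶ Y) : E.DescentDatum Y where
  g := s.g ≫ h
  γ := (α_ _ _ _).inv ≫ s.γ ▷ h ≫ (α_ _ _ _).hom
  unit := by
    have key : E.i₀ ◁ s.γ ▷ h = (α_ _ _ _).inv ≫ (E.i₀ ◁ s.γ) ▷ h ≫ (α_ _ _ _).hom := by simp
    rw [whiskerLeft_comp, whiskerLeft_comp, key, s.unit]
    generalize E.id₁.hom = x
    generalize E.id₀.inv = y
    bicategory
  cocycle := by
    have key {A : M} (a : A ⟶ E.level 1) :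
        a ◁ s.γ ▷ h = (α_ _ _ _).inv ≫ (a ◁ s.γ) ▷ h ≫ (α_ _ _ _).hom := by simp
    have hc := s.cocycle
    simp only [whiskerLeft_comp, key]
    generalize E.dd₂₀.hom = x at *
    generalize E.dd₀₀.hom = y at *
    generalize E.dd₂₁.hom = z at *
    generalize E.d (n := 1) 2 ◁ s.γ = k₂ at *
    generalize E.d (n := 1) 1 ◁ s.γ = k₁ at *
    generalize E.d (n := 1) 0 ◁ s.γ = k₀ at *
    trans (_ ◁ (α_ _ _ _).inv) ≫ (α_ _ _ _).inv ≫ (k₂ ≫ (α_ _ _ _).inv ≫ x ▷ s.g ≫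
      (α_ _ _ _).hom ≫ k₀ ≫ (α_ _ _ _).inv ≫ y ▷ s.g ≫ (α_ _ _ _).hom) ▷ h ≫
      (α_ _ _ _).hom ≫ _ ◁ (α_ _ _ _).hom
    · bicategory
    · rw [hc]
      bicategory

/-- A 2-cell between morphisms out of `B` induces a morphism of the pushed descent data. -/
lemma push_comm {B : M} (s : E.DescentDatum B) {h h' : B ⟶ Y} (β : h ⟶ h') :
    ((α_ _ _ _).inv ≫ s.γ ▷ h ≫ (α_ _ _ _).hom) ≫ E.d (n := 0) 0 ◁ s.g ◁ β =
      E.d (n := 0) 1 ◁ s.g ◁ β ≫ (α_ _ _ _).inv ≫ s.γ ▷ h' ≫ (α_ _ _ _).hom := by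
  trans (α_ _ _ _).inv ≫ (s.γ ▷ h ≫ (E.d (n := 0) 0 ≫ s.g) ◁ β) ≫ (α_ _ _ _).hom
  · simp
  · rw [← whisker_exchange]
    simp

/-- The comparison functor `M(B, Y) ⥤ Desc_p M(E, Y)` induced by a descent datum on `B`. -/
@[simps]
def comparison {B : M} (s : E.DescentDatum B) (Y : M) : (B ⟶ Y) ⥤ E.DescentDatum Y where
  obj h := s.push h
  map {h h'} β := ⟨s.g ◁ β, s.push_comm β⟩
  map_id h := Hom.ext (by simp; rfl)
  map_comp β β' := Hom.ext (by simp; rfl)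

end DescentDatum

/-- The morphism `p : E_0 ⟶ B` exhibits `B` as the (bicategorical) codescent object of `E`: there
is a 2-cell `λ : p d_1 ⟶ p d_0` making `(p, λ)` an object of `Desc_p M(E, B)` such that, for every
object `Y` of `M`, the induced functor `M(B, Y) ⥤ Desc_p M(E, Y)` is an equivalence. -/
def ExhibitsCodescentObject {B : M} (p : E.level 0 ⟶ B) : Prop :=
  ∃ s : E.DescentDatum B, s.g = p ∧ ∀ Y : M, (s.comparison Y).IsEquivalence

end PseudosimplicialObject

universe v u vC uC

set_option linter.checkUnivs false in
/-- The bicategory `F = Hom(Cᵒᵖ, Cat)` of pseudofunctors `Cᵒᵖ ⥤ Cat`, pseudonatural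
transformations and modifications. -/
abbrev ParamCat (C : Type uC) [Category.{vC} C] :=
  LocallyDiscrete Cᵒᵖ ⥤ᵖ Cat.{v, max u v}

/-- A morphism of `F` is e.s.o. if every component functor is essentially surjective on
objects. -/
def ParamCat.IsEso {C : Type uC} [Category.{vC} C] {X B : ParamCat.{v, u} C} (p : X ⟶ B) : Prop :=
  ∀ U : C, (p.app ⟨op U⟩).toFunctor.EssSurj

-- From 2 to 1: the essential image of a codescent morphism `p` is stable under restriction, because
-- `p` is natural up to isomorphism, so it forms a full sub-pseudofunctor `m : I ⟶ B` through which
-- `p` factors. Whiskering with `m` is bijective on 2-cells, so the descent datum on `B` lifts to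
-- `I`. The universal property at `I` turns the lift into `k : B ⟶ I`, and full faithfulness of the
-- comparison at `B` gives `k ≫ m ≅ 𝟙 B`. Hence every object of `B` is isomorphic to one in the
-- essential image (`exists_section_of_factorization`, `DescentDatum.isEso`).
--
-- From 1 to 2: let `E_n` over `U` consist of objects `x₀, …, xₙ` of `XU` with composable morphisms
-- `p x₀ ⟶ … ⟶ p xₙ` in `BU`; its morphisms are families in `XU` compatible with these. A 2-cell `γ`
-- on `g` assigns `g x ⟶ g y` to each `a : p x ⟶ p y`. The unit and cocycle conditions say that this
-- action is functorial, naturality of `γ` then says that it extends `g` on morphisms of `XU`, and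
-- the modification axiom says that it commutes with restriction (`unit_iff`, `cocycle_iff`,
-- `imageExtension`). A descent datum is thus an extension of `g` to the full image of `p`. When `p`
-- is essentially surjective, chosen isomorphisms `ξ b : p (σ b) ≅ b` extend it to `B`
-- (`ImageExtension.lift`), and 2-cells extend in the same way (`extendAt`).
--
-- One-vertex chains are only equivalent to `X`, while `E_0` has to be `X` itself; the simplicial
-- object is therefore transported along adjoint equivalences that are identities in positive
-- degrees. A chain contains morphisms of `BU`, so the universe of objects has to contain that of
-- morphisms.

universe w v' u' v₂ u₂ v₃ u₃ v₄ u₄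

/-! ### Lifting descent data along morphisms that are fully faithful on 2-cells. -/

namespace PseudosimplicialObject.DescentDatum

variable {M : Type u₁} [Bicategory.{w₁, v₁} M] {E : PseudosimplicialObject M}

/-- Transporting a descent datum along an isomorphism of its underlying morphism. -/
def ofIso {Y : M} (s : E.DescentDatum Y) {g : E.level 0 ⟶ Y} (φ : s.g ≅ g) :
    E.DescentDatum Y where
  g := g
  γ := E.d (n := 0) 1 ◁ φ.inv ≫ s.γ ≫ E.d (n := 0) 0 ◁ φ.hom
  unit := by
    have hu := s.unit
    simp only [whiskerLeft_comp, hu]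
    -- As opaque atoms, the structural 2-cells of `E` can be handled by `bicategory`.
    generalize E.id₁.hom = x
    generalize E.id₀.inv = y
    calc
      _ = 𝟙 _ ⊗≫ ((E.i₀ ≫ E.d 1) ◁ φ.inv ≫ x ▷ s.g) ⊗≫ (y ▷ s.g ≫
          (E.i₀ ≫ E.d 0) ◁ φ.hom) ⊗≫ 𝟙 _ := by bicategory
      _ = 𝟙 _ ⊗≫ x ▷ g ⊗≫ (φ.inv ≫ φ.hom) ⊗≫ y ▷ g ⊗≫ 𝟙 _ := by
        rw [whisker_exchange x φ.inv, ← whisker_exchange y φ.hom]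
        bicategory
      _ = _ := by
        rw [Iso.inv_hom_id]
        bicategory
  cocycle := by
    have hc := s.cocycle
    simp only [whiskerLeft_comp]
    generalize E.dd₂₀.hom = x at *
    generalize E.dd₀₀.hom = y at *
    generalize E.dd₂₁.hom = z at *
    generalize E.d (n := 1) 2 ◁ s.γ = k₂ at *
    generalize E.d (n := 1) 1 ◁ s.γ = k₁ at *
    generalize E.d (n := 1) 0 ◁ s.γ = k₀ at *
    calc
      _ = 𝟙 _ ⊗≫ (E.d 2 ≫ E.d 1) ◁ φ.inv ⊗≫ k₂ ⊗≫ ((E.d 2 ≫ E.d 0) ◁ φ.hom ≫ x ▷ g) ⊗≫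
          (E.d 0 ≫ E.d 1) ◁ φ.inv ⊗≫ k₀ ⊗≫ ((E.d 0 ≫ E.d 0) ◁ φ.hom ≫ y ▷ g) ⊗≫ 𝟙 _ := by
        bicategory
      -- The interchange law moves `φ.hom` past `x`, where it meets the `φ.inv` of the next copy of
      -- the conjugated 2-cell.
      _ = 𝟙 _ ⊗≫ (E.d 2 ≫ E.d 1) ◁ φ.inv ⊗≫ k₂ ⊗≫ x ▷ s.g ⊗≫
          (E.d 0 ≫ E.d 1) ◁ (φ.hom ≫ φ.inv) ⊗≫ k₀ ⊗≫ y ▷ s.g ⊗≫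
          (E.d 1 ≫ E.d 0) ◁ φ.hom ⊗≫ 𝟙 _ := by
        rw [whisker_exchange, whisker_exchange]
        bicategory
      _ = 𝟙 _ ⊗≫ (E.d 2 ≫ E.d 1) ◁ φ.inv ⊗≫ (k₂ ≫ (α_ _ _ _).inv ≫ x ▷ s.g ≫ (α_ _ _ _).hom ≫
          k₀ ≫ (α_ _ _ _).inv ≫ y ▷ s.g ≫ (α_ _ _ _).hom) ⊗≫
          (E.d 1 ≫ E.d 0) ◁ φ.hom ⊗≫ 𝟙 _ := by
        rw [Iso.hom_inv_id]
        bicategory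
      _ = 𝟙 _ ⊗≫ ((E.d 2 ≫ E.d 1) ◁ φ.inv ≫ z ▷ s.g) ⊗≫ k₁ ⊗≫
          (E.d 1 ≫ E.d 0) ◁ φ.hom ⊗≫ 𝟙 _ := by
        rw [hc]
        bicategory
      _ = _ := by
        rw [whisker_exchange]
        bicategory

/-- A descent datum whose underlying morphism factors through a morphism `m` lifts along `m`, if
whiskering with `m` is injective on 2-cells and the 2-cell of the datum lifts. -/
def lift {I B : M} (s : E.DescentDatum B) (m : I ⟶ B)
    (hm : ∀ {Z : M} {f g : Z ⟶ I} {β β' : f ⟶ g}, β ▷ m = β' ▷ m → β = β')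
    {e : E.level 0 ⟶ I} (φ : s.g ≅ e ≫ m) (γ : E.d (n := 0) 1 ≫ e ⟶ E.d (n := 0) 0 ≫ e)
    (hγ : E.d (n := 0) 1 ◁ φ.inv ≫ s.γ ≫ E.d (n := 0) 0 ◁ φ.hom =
      (α_ _ _ _).inv ≫ γ ▷ m ≫ (α_ _ _ _).hom) :
    E.DescentDatum I where
  g := e
  γ := γ
  unit := by
    -- After whiskering with `m`, the 2-cell `γ` becomes that of `s.ofIso φ`, whose axioms are
    -- known; `hm` reflects them.
    have hu : E.i₀ ◁ ((α_ _ _ _).inv ≫ γ ▷ m ≫ (α_ _ _ _).hom) = (α_ _ _ _).inv ≫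
        E.id₁.hom ▷ (e ≫ m) ≫ E.id₀.inv ▷ (e ≫ m) ≫ (α_ _ _ _).hom := by
      rw [← hγ]
      exact (s.ofIso φ).unit
    apply hm
    generalize E.id₁.hom = x at *
    generalize E.id₀.inv = y at *
    calc
      _ = (α_ _ _ _).hom ≫ _ ◁ (α_ _ _ _).hom ≫ E.i₀ ◁ ((α_ _ _ _).inv ≫ γ ▷ m ≫ (α_ _ _ _).hom) ≫
          _ ◁ (α_ _ _ _).inv ≫ (α_ _ _ _).inv := by bicategory
      _ = _ := by
        rw [hu]
        bicategory
  cocycle := by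
    have hc : E.d (n := 1) 2 ◁ ((α_ _ _ _).inv ≫ γ ▷ m ≫ (α_ _ _ _).hom) ≫ (α_ _ _ _).inv ≫
        E.dd₂₀.hom ▷ (e ≫ m) ≫ (α_ _ _ _).hom ≫
        E.d (n := 1) 0 ◁ ((α_ _ _ _).inv ≫ γ ▷ m ≫ (α_ _ _ _).hom) ≫ (α_ _ _ _).inv ≫
        E.dd₀₀.hom ▷ (e ≫ m) ≫ (α_ _ _ _).hom = (α_ _ _ _).inv ≫ E.dd₂₁.hom ▷ (e ≫ m) ≫
        (α_ _ _ _).hom ≫ E.d (n := 1) 1 ◁ ((α_ _ _ _).inv ≫ γ ▷ m ≫ (α_ _ _ _).hom) := by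
      rw [← hγ]
      exact (s.ofIso φ).cocycle
    apply hm
    generalize E.dd₂₀.hom = x at *
    generalize E.dd₀₀.hom = y at *
    generalize E.dd₂₁.hom = z at *
    trans (α_ _ _ _).hom ≫ _ ◁ (α_ _ _ _).hom ≫
      (E.d (n := 1) 2 ◁ ((α_ _ _ _).inv ≫ γ ▷ m ≫ (α_ _ _ _).hom) ≫ (α_ _ _ _).inv ≫
        x ▷ (e ≫ m) ≫ (α_ _ _ _).hom ≫
        E.d (n := 1) 0 ◁ ((α_ _ _ _).inv ≫ γ ▷ m ≫ (α_ _ _ _).hom) ≫ (α_ _ _ _).inv ≫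
        y ▷ (e ≫ m) ≫ (α_ _ _ _).hom) ≫ _ ◁ (α_ _ _ _).inv ≫ (α_ _ _ _).inv
    · bicategory
    · rw [hc]
      bicategory

/-- An isomorphism between the underlying morphisms of two descent data that is compatible with
their 2-cells. -/
def isoMk {Y : M} {s t : E.DescentDatum Y} (u : s.g ≅ t.g)
    (comm : s.γ ≫ E.d (n := 0) 0 ◁ u.hom = E.d (n := 0) 1 ◁ u.hom ≫ t.γ) : s ≅ t where
  hom := ⟨u.hom, comm⟩
  inv := ⟨u.inv, by
    rw [← cancel_epi (E.d (n := 0) 1 ◁ u.hom), ← reassoc_of% comm, ← whiskerLeft_comp,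
      ← whiskerLeft_comp_assoc]
    simp⟩
  hom_inv_id := Hom.ext u.hom_inv_id
  inv_hom_id := Hom.ext u.inv_hom_id

/-- The isomorphism of underlying morphisms given by an isomorphism of descent data. -/
def underlyingIso {Y : M} {s t : E.DescentDatum Y} (ψ : s ≅ t) : s.g ≅ t.g where
  hom := ψ.hom.u
  inv := ψ.inv.u
  hom_inv_id := congrArg Hom.u ψ.hom_inv_id
  inv_hom_id := congrArg Hom.u ψ.inv_hom_id

/-- If `s` exhibits `B` as a codescent object, and `s.g` factors up to isomorphism through a
morphism `m` that is fully faithful on 2-cells, then `m` has a pseudo-section. -/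
lemma exists_section_of_factorization {B I : M} (s : E.DescentDatum B)
    (hs : ∀ Y : M, (s.comparison Y).IsEquivalence) (m : I ⟶ B)
    (hm : ∀ {Z : M} (f g : Z ⟶ I), Function.Bijective (fun β : f ⟶ g ↦ β ▷ m))
    (e : E.level 0 ⟶ I) (φ : s.g ≅ e ≫ m) : ∃ k : B ⟶ I, Nonempty (k ≫ m ≅ 𝟙 B) := by
  -- The 2-cell of `s`, conjugated by `φ`, comes from `I` by fullness of whiskering with `m`.
  obtain ⟨γ, hγ : γ ▷ m = _⟩ := (hm (E.d (n := 0) 1 ≫ e) (E.d (n := 0) 0 ≫ e)).2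
    ((α_ _ _ _).hom ≫ (E.d (n := 0) 1 ◁ φ.inv ≫ s.γ ≫ E.d (n := 0) 0 ◁ φ.hom) ≫ (α_ _ _ _).inv)
  have := hs I
  have := hs B
  obtain ⟨k, ψ, hψ⟩ : ∃ (k : B ⟶ I) (ψ : s.g ≫ k ≅ e),
      ((α_ _ _ _).inv ≫ s.γ ▷ k ≫ (α_ _ _ _).hom) ≫ E.d (n := 0) 0 ◁ ψ.hom =
        E.d (n := 0) 1 ◁ ψ.hom ≫ γ := by
    let r := s.lift m (fun {_ _ _ _ _} h ↦ (hm _ _).1 h) φ γ (by rw [hγ]; simp)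
    let ψ := (s.comparison I).objObjPreimageIso r
    exact ⟨(s.comparison I).objPreimage r, underlyingIso ψ, ψ.hom.comm⟩
  let θ : s.g ≫ k ≫ m ≅ s.g ≫ 𝟙 B :=
    (α_ _ _ _).symm ≪≫ whiskerRightIso ψ m ≪≫ φ.symm ≪≫ (ρ_ _).symm
  -- This makes `θ` an isomorphism between the images of `k ≫ m` and `𝟙 B` under the comparison at
  -- `B`, which is fully faithful and so reflects it.
  suffices h : ((α_ _ _ _).inv ≫ s.γ ▷ (k ≫ m) ≫ (α_ _ _ _).hom) ≫ E.d (n := 0) 0 ◁ θ.hom =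
      E.d (n := 0) 1 ◁ θ.hom ≫ (α_ _ _ _).inv ≫ s.γ ▷ 𝟙 B ≫ (α_ _ _ _).hom from
    ⟨k, ⟨(s.comparison B).preimageIso (isoMk (s := s.push (k ≫ m)) (t := s.push (𝟙 B)) θ h)⟩⟩
  simp only [θ, Iso.trans_hom, Iso.symm_hom, Bicategory.whiskerRightIso_hom]
  generalize ψ.hom = ψ' at *
  calc
    _ = 𝟙 _ ⊗≫ (((α_ _ _ _).inv ≫ s.γ ▷ k ≫ (α_ _ _ _).hom) ≫ E.d (n := 0) 0 ◁ ψ') ▷ m ⊗≫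
          E.d (n := 0) 0 ◁ φ.inv ⊗≫ 𝟙 _ := by bicategory
    _ = 𝟙 _ ⊗≫ E.d (n := 0) 1 ◁ ψ' ▷ m ⊗≫ γ ▷ m ⊗≫ E.d (n := 0) 0 ◁ φ.inv ⊗≫ 𝟙 _ := by
      rw [hψ]
      bicategory
    _ = 𝟙 _ ⊗≫ E.d (n := 0) 1 ◁ ψ' ▷ m ⊗≫ E.d (n := 0) 1 ◁ φ.inv ≫ s.γ ⊗≫
          E.d (n := 0) 0 ◁ (φ.hom ≫ φ.inv) ⊗≫ 𝟙 _ := by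
      rw [hγ]
      bicategory
    _ = _ := by
      rw [Iso.hom_inv_id]
      bicategory

end PseudosimplicialObject.DescentDatum

/-! ### Componentwise calculus for `Cat`-valued pseudofunctors. -/

namespace CategoryTheory.Pseudofunctor

variable {D : Type u} [Bicategory.{w, v} D] (F : D ⥤ᵖ Cat.{v', u'}) {G H : D ⥤ᵖ Cat.{v', u'}}

/-- The component of `F.map₂ α` at an object. -/
def map₂At {U V : D} {f g : U ⟶ V} (α : f ⟶ g) (x : F.obj U) :
    (F.map f).toFunctor.obj x ⟶ (F.map g).toFunctor.obj x :=
  (F.map₂ α).toNatTrans.app x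

/-- The component of `F.mapId` at an object. -/
def mapIdAt {U : D} (x : F.obj U) : (F.map (𝟙 U)).toFunctor.obj x ≅ x :=
  (Cat.Hom.toNatIso (F.mapId U)).app x

/-- The component of `F.mapComp` at an object. -/
def mapCompAt {U V W : D} (f : U ⟶ V) (g : V ⟶ W) (x : F.obj U) :
    (F.map (f ≫ g)).toFunctor.obj x ≅ (F.map g).toFunctor.obj ((F.map f).toFunctor.obj x) :=
  (Cat.Hom.toNatIso (F.mapComp f g)).app x

lemma map₂At_naturality {U V : D} {f g : U ⟶ V} (α : f ⟶ g) {x y : F.obj U} (a : x ⟶ y) :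
    (F.map f).toFunctor.map a ≫ F.map₂At α y = F.map₂At α x ≫ (F.map g).toFunctor.map a :=
  (F.map₂ α).toNatTrans.naturality a

lemma mapIdAt_naturality {U : D} {x y : F.obj U} (a : x ⟶ y) :
    (F.map (𝟙 U)).toFunctor.map a ≫ (F.mapIdAt y).hom = (F.mapIdAt x).hom ≫ a :=
  (F.mapId U).hom.toNatTrans.naturality a

lemma mapCompAt_naturality {U V W : D} (f : U ⟶ V) (g : V ⟶ W) {x y : F.obj U} (a : x ⟶ y) :
    (F.map (f ≫ g)).toFunctor.map a ≫ (F.mapCompAt f g y).hom =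
      (F.mapCompAt f g x).hom ≫ (F.map g).toFunctor.map ((F.map f).toFunctor.map a) :=
  (F.mapComp f g).hom.toNatTrans.naturality a

@[simp]
lemma map₂At_id {U V : D} (f : U ⟶ V) (x : F.obj U) : F.map₂At (𝟙 f) x = 𝟙 _ :=
  congr_arg (fun t ↦ t.toNatTrans.app x) (F.map₂_id f)

lemma map₂At_comp {U V : D} {f g h : U ⟶ V} (α : f ⟶ g) (β : g ⟶ h) (x : F.obj U) :
    F.map₂At (α ≫ β) x = F.map₂At α x ≫ F.map₂At β x :=
  congr_arg (fun t ↦ t.toNatTrans.app x) (F.map₂_comp α β)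

lemma map₂At_whiskerLeft {U V W : D} (f : U ⟶ V) {g h : V ⟶ W} (α : g ⟶ h) (x : F.obj U) :
    F.map₂At (f ◁ α) x = (F.mapCompAt f g x).hom ≫ F.map₂At α ((F.map f).toFunctor.obj x) ≫
      (F.mapCompAt f h x).inv :=
  congr_arg (fun t ↦ t.toNatTrans.app x) (F.map₂_whisker_left f α)

lemma map₂At_whiskerRight {U V W : D} {f g : U ⟶ V} (α : f ⟶ g) (h : V ⟶ W) (x : F.obj U) :
    F.map₂At (α ▷ h) x = (F.mapCompAt f h x).hom ≫ (F.map h).toFunctor.map (F.map₂At α x) ≫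
      (F.mapCompAt g h x).inv :=
  congr_arg (fun t ↦ t.toNatTrans.app x) (F.map₂_whisker_right α h)

lemma map₂At_associator {U V W Z : D} (f : U ⟶ V) (g : V ⟶ W) (h : W ⟶ Z) (x : F.obj U) :
    F.map₂At (α_ f g h).hom x = (F.mapCompAt (f ≫ g) h x).hom ≫
      (F.map h).toFunctor.map (F.mapCompAt f g x).hom ≫
      (F.mapCompAt g h ((F.map f).toFunctor.obj x)).inv ≫ (F.mapCompAt f (g ≫ h) x).inv :=
  (congr_arg (fun t ↦ t.toNatTrans.app x) (F.map₂_associator f g h)).trans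
    (congr_arg (fun t ↦ (F.mapCompAt (f ≫ g) h x).hom ≫
      (F.map h).toFunctor.map (F.mapCompAt f g x).hom ≫ t) (Category.id_comp _))

lemma map₂At_leftUnitor {U V : D} (f : U ⟶ V) (x : F.obj U) :
    F.map₂At (λ_ f).hom x = (F.mapCompAt (𝟙 U) f x).hom ≫
      (F.map f).toFunctor.map (F.mapIdAt x).hom :=
  (congr_arg (fun t ↦ t.toNatTrans.app x) (F.map₂_left_unitor f)).trans
    (congr_arg (fun t ↦ (F.mapCompAt (𝟙 U) f x).hom ≫ t) (Category.comp_id _))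

lemma map₂At_rightUnitor {U V : D} (f : U ⟶ V) (x : F.obj U) :
    F.map₂At (ρ_ f).hom x = (F.mapCompAt f (𝟙 V) x).hom ≫
      (F.mapIdAt ((F.map f).toFunctor.obj x)).hom :=
  (congr_arg (fun t ↦ t.toNatTrans.app x) (F.map₂_right_unitor f)).trans
    (congr_arg (fun t ↦ (F.mapCompAt f (𝟙 V) x).hom ≫ t) (Category.comp_id _))

/-- A `Cat`-valued pseudofunctor, given by components. -/
def mkOfComponents (obj : D → Cat.{v', u'}) (map : ∀ {U V : D}, (U ⟶ V) → (obj U ⥤ obj V))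
    (map₂ : ∀ {U V : D} {f g : U ⟶ V}, (f ⟶ g) → (map f ⟶ map g))
    (mapId : ∀ U : D, map (𝟙 U) ≅ 𝟭 (obj U))
    (mapComp : ∀ {U V W : D} (f : U ⟶ V) (g : V ⟶ W), map (f ≫ g) ≅ map f ⋙ map g)
    (map₂_id : ∀ {U V : D} (f : U ⟶ V) (x : obj U), (map₂ (𝟙 f)).app x = 𝟙 _)
    (map₂_comp : ∀ {U V : D} {f g h : U ⟶ V} (α : f ⟶ g) (β : g ⟶ h) (x : obj U),
      (map₂ (α ≫ β)).app x = (map₂ α).app x ≫ (map₂ β).app x)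
    (map₂_whiskerLeft : ∀ {U V W : D} (f : U ⟶ V) {g h : V ⟶ W} (α : g ⟶ h) (x : obj U),
      (map₂ (f ◁ α)).app x = (mapComp f g).hom.app x ≫ (map₂ α).app ((map f).obj x) ≫
        (mapComp f h).inv.app x)
    (map₂_whiskerRight : ∀ {U V W : D} {f g : U ⟶ V} (α : f ⟶ g) (h : V ⟶ W) (x : obj U),
      (map₂ (α ▷ h)).app x = (mapComp f h).hom.app x ≫ (map h).map ((map₂ α).app x) ≫
        (mapComp g h).inv.app x)
    (map₂_associator : ∀ {U V W Z : D} (f : U ⟶ V) (g : V ⟶ W) (h : W ⟶ Z) (x : obj U),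
      (map₂ (α_ f g h).hom).app x = (mapComp (f ≫ g) h).hom.app x ≫
        (map h).map ((mapComp f g).hom.app x) ≫ (mapComp g h).inv.app ((map f).obj x) ≫
        (mapComp f (g ≫ h)).inv.app x)
    (map₂_leftUnitor : ∀ {U V : D} (f : U ⟶ V) (x : obj U),
      (map₂ (λ_ f).hom).app x = (mapComp (𝟙 U) f).hom.app x ≫ (map f).map ((mapId U).hom.app x))
    (map₂_rightUnitor : ∀ {U V : D} (f : U ⟶ V) (x : obj U),
      (map₂ (ρ_ f).hom).app x =
        (mapComp f (𝟙 V)).hom.app x ≫ (mapId V).hom.app ((map f).obj x)) :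
    D ⥤ᵖ Cat.{v', u'} where
  obj := obj
  map f := ⟨map f⟩
  map₂ α := ⟨map₂ α⟩
  map₂_id f := Cat.Hom₂.ext (NatTrans.ext (funext (map₂_id f)))
  map₂_comp α β := Cat.Hom₂.ext (NatTrans.ext (funext (map₂_comp α β)))
  mapId U := Cat.Hom.isoMk (mapId U)
  mapComp f g := Cat.Hom.isoMk (mapComp f g)
  map₂_whisker_left f _ _ α := Cat.Hom₂.ext (NatTrans.ext (funext (map₂_whiskerLeft f α)))
  map₂_whisker_right α h := Cat.Hom₂.ext (NatTrans.ext (funext (map₂_whiskerRight α h)))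
  map₂_associator f g h := Cat.Hom₂.ext (NatTrans.ext (funext fun x ↦
    (map₂_associator f g h x).trans (congr_arg (fun t ↦ (mapComp (f ≫ g) h).hom.app x ≫
      (map h).map ((mapComp f g).hom.app x) ≫ t) (Category.id_comp _).symm)))
  map₂_left_unitor f := Cat.Hom₂.ext (NatTrans.ext (funext fun x ↦
    (map₂_leftUnitor f x).trans (congr_arg (fun t ↦ (mapComp (𝟙 _) f).hom.app x ≫ t)
      (Category.comp_id _).symm)))
  map₂_right_unitor f := Cat.Hom₂.ext (NatTrans.ext (funext fun x ↦
    (map₂_rightUnitor f x).trans (congr_arg (fun t ↦ (mapComp f (𝟙 _)).hom.app x ≫ t)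
      (Category.comp_id _).symm)))

namespace StrongTrans

variable {F}

/-- The component of the naturality constraint of a transformation at an object. -/
def natAt (η : F ⟶ G) {U V : D} (f : U ⟶ V) (x : F.obj U) :
    (η.app V).toFunctor.obj ((F.map f).toFunctor.obj x) ≅
      (G.map f).toFunctor.obj ((η.app U).toFunctor.obj x) :=
  (Cat.Hom.toNatIso (η.naturality f)).app x

/-- The component of a modification at an object. -/
def homAt {η θ : F ⟶ G} (Γ : η ⟶ θ) {U : D} (x : F.obj U) :
    (η.app U).toFunctor.obj x ⟶ (θ.app U).toFunctor.obj x :=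
  (Γ.as.app U).toNatTrans.app x

lemma natAt_naturality (η : F ⟶ G) {U V : D} (f : U ⟶ V) {x y : F.obj U} (a : x ⟶ y) :
    (η.app V).toFunctor.map ((F.map f).toFunctor.map a) ≫ (natAt η f y).hom =
      (natAt η f x).hom ≫ (G.map f).toFunctor.map ((η.app U).toFunctor.map a) :=
  (η.naturality f).hom.toNatTrans.naturality a

lemma natAt_map₂At (η : F ⟶ G) {U V : D} {f g : U ⟶ V} (α : f ⟶ g) (x : F.obj U) :
    (η.app V).toFunctor.map (F.map₂At α x) ≫ (natAt η g x).hom =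
      (natAt η f x).hom ≫ G.map₂At α ((η.app U).toFunctor.obj x) :=
  congr_arg (fun t ↦ t.toNatTrans.app x) (η.naturality_naturality α)

lemma natAt_id (η : F ⟶ G) {U : D} (x : F.obj U) :
    (natAt η (𝟙 U) x).hom ≫ (G.mapIdAt ((η.app U).toFunctor.obj x)).hom =
      (η.app U).toFunctor.map (F.mapIdAt x).hom :=
  (congr_arg (fun t ↦ t.toNatTrans.app x) (η.naturality_id U)).trans
    ((congr_arg (fun t ↦ (η.app U).toFunctor.map (F.mapIdAt x).hom ≫ t)
      (Category.comp_id _)).trans (Category.comp_id _))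

lemma natAt_comp (η : F ⟶ G) {U V W : D} (f : U ⟶ V) (g : V ⟶ W) (x : F.obj U) :
    (natAt η (f ≫ g) x).hom ≫ (G.mapCompAt f g ((η.app U).toFunctor.obj x)).hom =
      (η.app W).toFunctor.map (F.mapCompAt f g x).hom ≫
        (natAt η g ((F.map f).toFunctor.obj x)).hom ≫
        (G.map g).toFunctor.map (natAt η f x).hom :=
  (congr_arg (fun t ↦ t.toNatTrans.app x) (η.naturality_comp f g)).trans
    (congr_arg (fun t ↦ (η.app W).toFunctor.map (F.mapCompAt f g x).hom ≫ t)
      ((Category.id_comp _).trans (congr_arg (fun t ↦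
        (natAt η g ((F.map f).toFunctor.obj x)).hom ≫ t)
        ((Category.id_comp _).trans (Category.comp_id _)))))

lemma natAt_comp_trans (η : F ⟶ G) (θ : G ⟶ H) {U V : D} (f : U ⟶ V) (x : F.obj U) :
    (natAt (η ≫ θ) f x).hom = (θ.app V).toFunctor.map (natAt η f x).hom ≫
      (natAt θ f ((η.app U).toFunctor.obj x)).hom :=
  (congr_arg (fun t ↦ t.toNatTrans.app x) (categoryStruct_comp_naturality_hom η θ f)).trans
    ((Category.id_comp _).trans (congr_arg (fun t ↦ (θ.app V).toFunctor.map (natAt η f x).hom ≫ t)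
        ((Category.id_comp _).trans (Category.comp_id _))))

lemma natAt_id_trans {U V : D} (f : U ⟶ V) (x : F.obj U) :
    (natAt (𝟙 F) f x).hom = 𝟙 ((F.map f).toFunctor.obj x) :=
  (congr_arg (fun t ↦ t.toNatTrans.app x) (categoryStruct_id_naturality_hom F f)).trans
    (Category.comp_id _)

lemma homAt_naturality {η θ : F ⟶ G} (Γ : η ⟶ θ) {U : D} {x y : F.obj U} (a : x ⟶ y) :
    (η.app U).toFunctor.map a ≫ homAt Γ y = homAt Γ x ≫ (θ.app U).toFunctor.map a :=
  (Γ.as.app U).toNatTrans.naturality a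

lemma homAt_natAt {η θ : F ⟶ G} (Γ : η ⟶ θ) {U V : D} (f : U ⟶ V) (x : F.obj U) :
    homAt Γ ((F.map f).toFunctor.obj x) ≫ (natAt θ f x).hom =
      (natAt η f x).hom ≫ (G.map f).toFunctor.map (homAt Γ x) :=
  congr_arg (fun t ↦ t.toNatTrans.app x) (Γ.as.naturality f)

lemma hom_ext_at {η θ : F ⟶ G} {Γ Γ' : η ⟶ θ}
    (h : ∀ (U : D) (x : F.obj U), homAt Γ x = homAt Γ' x) : Γ = Γ' := by
  ext U x
  exact h U x

@[simp]
lemma homAt_id (η : F ⟶ G) {U : D} (x : F.obj U) : homAt (𝟙 η) x = 𝟙 _ := rfl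

@[simp]
lemma homAt_comp {η θ κ : F ⟶ G} (Γ : η ⟶ θ) (Γ' : θ ⟶ κ) {U : D} (x : F.obj U) :
    homAt (Γ ≫ Γ') x = homAt Γ x ≫ homAt Γ' x := rfl

lemma homAt_eqToHom {η θ : F ⟶ G} (h : η = θ) {U : D} (x : F.obj U) :
    homAt (eqToHom h) x = eqToHom (by rw [h]) := by
  subst h
  rfl

/-- A 2-cell between transformations of `Cat`-valued pseudofunctors, given by components. -/
def homOfComponents {η θ : F ⟶ G}
    (app : ∀ (U : D) (x : F.obj U), (η.app U).toFunctor.obj x ⟶ (θ.app U).toFunctor.obj x)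
    (nat : ∀ (U : D) {x y : F.obj U} (a : x ⟶ y),
      (η.app U).toFunctor.map a ≫ app U y = app U x ≫ (θ.app U).toFunctor.map a)
    (mod : ∀ {U V : D} (f : U ⟶ V) (x : F.obj U),
      app V ((F.map f).toFunctor.obj x) ≫ (natAt θ f x).hom =
        (natAt η f x).hom ≫ (G.map f).toFunctor.map (app U x)) : η ⟶ θ where
  as :=
    { app U := ⟨{ app := app U, naturality _ _ a := nat U a }⟩
      naturality f := Cat.Hom₂.ext (NatTrans.ext (funext (mod f))) }

/-- An invertible 2-cell between transformations of `Cat`-valued pseudofunctors, given by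
components. -/
def isoOfComponents {η θ : F ⟶ G}
    (app : ∀ (U : D) (x : F.obj U), (η.app U).toFunctor.obj x ≅ (θ.app U).toFunctor.obj x)
    (nat : ∀ (U : D) {x y : F.obj U} (a : x ⟶ y),
      (η.app U).toFunctor.map a ≫ (app U y).hom = (app U x).hom ≫ (θ.app U).toFunctor.map a)
    (mod : ∀ {U V : D} (f : U ⟶ V) (x : F.obj U),
      (app V ((F.map f).toFunctor.obj x)).hom ≫ (natAt θ f x).hom =
        (natAt η f x).hom ≫ (G.map f).toFunctor.map (app U x).hom) :
    η ≅ θ where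
  hom := homOfComponents (fun U x ↦ (app U x).hom) nat mod
  inv := homOfComponents (fun U x ↦ (app U x).inv)
    (fun U x y a ↦ by rw [Iso.eq_inv_comp, ← reassoc_of% nat, Iso.hom_inv_id, Category.comp_id])
    (fun f x ↦ by
      rw [Iso.inv_comp_eq, reassoc_of% mod, ← Functor.map_comp, Iso.hom_inv_id, Functor.map_id,
        Category.comp_id])
  hom_inv_id := hom_ext_at fun U x ↦ (app U x).hom_inv_id
  inv_hom_id := hom_ext_at fun U x ↦ (app U x).inv_hom_id

/-- The component of an invertible modification at an object. -/
@[simps]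
def isoAt {η θ : F ⟶ G} (Γ : η ≅ θ) {U : D} (x : F.obj U) :
    (η.app U).toFunctor.obj x ≅ (θ.app U).toFunctor.obj x where
  hom := homAt Γ.hom x
  inv := homAt Γ.inv x
  hom_inv_id := by rw [← homAt_comp, Γ.hom_inv_id, homAt_id]
  inv_hom_id := by rw [← homAt_comp, Γ.inv_hom_id, homAt_id]

/-- A transformation of `Cat`-valued pseudofunctors, given by components. -/
def mkOfComponents (app : ∀ U : D, F.obj U ⥤ G.obj U)
    (naturality : ∀ {U V : D} (f : U ⟶ V) (x : F.obj U),
      (app V).obj ((F.map f).toFunctor.obj x) ≅ (G.map f).toFunctor.obj ((app U).obj x))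
    (nat : ∀ {U V : D} (f : U ⟶ V) {x y : F.obj U} (a : x ⟶ y),
      (app V).map ((F.map f).toFunctor.map a) ≫ (naturality f y).hom =
        (naturality f x).hom ≫ (G.map f).toFunctor.map ((app U).map a))
    (naturality_naturality : ∀ {U V : D} {f g : U ⟶ V} (α : f ⟶ g) (x : F.obj U),
      (app V).map (F.map₂At α x) ≫ (naturality g x).hom =
        (naturality f x).hom ≫ G.map₂At α ((app U).obj x))
    (naturality_id : ∀ {U : D} (x : F.obj U),
      (naturality (𝟙 U) x).hom ≫ (G.mapIdAt ((app U).obj x)).hom =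
        (app U).map (F.mapIdAt x).hom)
    (naturality_comp : ∀ {U V W : D} (f : U ⟶ V) (g : V ⟶ W) (x : F.obj U),
      (naturality (f ≫ g) x).hom ≫ (G.mapCompAt f g ((app U).obj x)).hom =
        (app W).map (F.mapCompAt f g x).hom ≫
          (naturality g ((F.map f).toFunctor.obj x)).hom ≫
          (G.map g).toFunctor.map (naturality f x).hom) : F ⟶ G where
  app U := ⟨app U⟩
  naturality f := Cat.Hom.isoMk (NatIso.ofComponents (naturality f) (nat f))
  naturality_naturality α := Cat.Hom₂.ext (NatTrans.ext (funext (naturality_naturality α)))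
  naturality_id U := Cat.Hom₂.ext (NatTrans.ext (funext fun x ↦
    (naturality_id x).trans ((Category.comp_id _).symm.trans
      (congr_arg (fun t ↦ (app U).map (F.mapIdAt x).hom ≫ t) (Category.comp_id _).symm))))
  naturality_comp {_ _ W} f g := Cat.Hom₂.ext (NatTrans.ext (funext fun x ↦
    (naturality_comp f g x).trans (congr_arg (fun t ↦ (app W).map (F.mapCompAt f g x).hom ≫ t)
      ((Category.id_comp _).trans (congr_arg (fun t ↦
        (naturality g ((F.map f).toFunctor.obj x)).hom ≫ t)
        ((Category.id_comp _).trans (Category.comp_id _)))).symm)))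

end StrongTrans

/-! ### Full sub-pseudofunctors. -/

namespace ObjectProperty

variable {X F : D ⥤ᵖ Cat.{v', u'}} (P : F.ObjectProperty) [P.IsClosedUnderMapObj]

open StrongTrans

lemma natAt_comp_ι {Z : D ⥤ᵖ Cat.{v', u'}} (k : Z ⟶ P.fullsubcategory) {U V : D} (f : U ⟶ V)
    (x : Z.obj U) :
    (natAt (k ≫ (P.ι : P.fullsubcategory ⟶ F)) f x).hom = (natAt k f x).hom.hom :=
  (natAt_comp_trans k P.ι f x).trans (Category.comp_id _)

/-- Fullness makes the components and their naturality the same before and after inclusion. The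
modification axiom transfers because the inclusion is strict, by `natAt_comp_ι`. -/
lemma whiskerRight_ι_bijective {Z : D ⥤ᵖ Cat.{v', u'}} (f g : Z ⟶ P.fullsubcategory) :
    Function.Bijective (fun β : f ⟶ g ↦ β ▷ (P.ι : P.fullsubcategory ⟶ F)) := by
  refine ⟨fun β β' h ↦ hom_ext_at fun U x ↦ ObjectProperty.hom_ext _
    (congr_arg (fun θ ↦ homAt θ x) h), fun θ ↦ ⟨homOfComponents
      (fun U x ↦ ObjectProperty.homMk (homAt θ x))
      (fun U x y a ↦ ObjectProperty.hom_ext _ (homAt_naturality θ a))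
      (fun {U V} a x ↦ ObjectProperty.hom_ext _ ?_), rfl⟩⟩
  have := homAt_natAt θ a x
  rw [natAt_comp_ι, natAt_comp_ι] at this
  exact this

/-- A transformation into `F` whose components take values in `P` factors through the
sub-pseudofunctor defined by `P`. -/
def liftTrans (p : X ⟶ F) (hp : ∀ U x, P.prop U ((p.app U).toFunctor.obj x)) :
    X ⟶ P.fullsubcategory :=
  StrongTrans.mkOfComponents (fun U ↦ (P.prop U).lift (p.app U).toFunctor (hp U))
    (fun f x ↦ (P.prop _).isoMk (natAt p f x))
    (fun f _ _ a ↦ ObjectProperty.hom_ext _ (natAt_naturality p f a))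
    (fun α x ↦ ObjectProperty.hom_ext _ (natAt_map₂At p α x))
    (fun x ↦ ObjectProperty.hom_ext _ (natAt_id p x))
    (fun f g x ↦ ObjectProperty.hom_ext _ (natAt_comp p f g x))

/-- The factorization of `p` through `liftTrans`. -/
def liftTransιIso (p : X ⟶ F) (hp : ∀ U x, P.prop U ((p.app U).toFunctor.obj x)) :
    p ≅ P.liftTrans p hp ≫ (P.ι : P.fullsubcategory ⟶ F) :=
  isoOfComponents (fun U x ↦ Iso.refl ((p.app U).toFunctor.obj x))
    (fun U _ _ a ↦ (Category.comp_id _).trans (Category.id_comp _).symm)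
    (fun {_ V} f x ↦ by
      rw [natAt_comp_ι]
      exact (Category.id_comp _).trans ((Category.comp_id _).symm.trans
        (congr_arg (fun t ↦ (natAt p f x).hom ≫ t) (Functor.map_id _ _).symm)))

end ObjectProperty

end CategoryTheory.Pseudofunctor

/-! ### Essential surjectivity of codescent morphisms. -/

/-- A codescent morphism of `ParamCat` is pointwise essentially surjective on objects. -/
lemma PseudosimplicialObject.DescentDatum.isEso {C : Type uC} [Category.{vC} C]
    {E : PseudosimplicialObject (ParamCat.{v, u} C)} {B : ParamCat.{v, u} C}
    (s : E.DescentDatum B) (hs : ∀ Y, (s.comparison Y).IsEquivalence) : ParamCat.IsEso s.g := by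
  let P : B.ObjectProperty := ⟨fun U ↦ (s.g.app U).toFunctor.essImage⟩
  have : P.IsClosedUnderMapObj := ⟨by
    rintro U V b ⟨x, ⟨e⟩⟩ f
    exact ⟨((E.level 0).map f).toFunctor.obj x, ⟨Pseudofunctor.StrongTrans.natAt s.g f x ≪≫
      (B.map f).toFunctor.mapIso e⟩⟩⟩
  have hp (U x) : P.prop U ((s.g.app U).toFunctor.obj x) := Functor.obj_mem_essImage _ _
  obtain ⟨k, ⟨ψ⟩⟩ := s.exists_section_of_factorization hs (I := P.fullsubcategory) P.ι
    P.whiskerRight_ι_bijective (P.liftTrans s.g hp) (P.liftTransιIso s.g hp)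
  refine fun U ↦ ⟨fun b ↦ ?_⟩
  -- Objects of `I` carry a proof of lying in the essential image, and `ψ` identifies the image of
  -- `k b` with `b`.
  obtain ⟨x, ⟨e⟩⟩ := ((k.app ⟨op U⟩).toFunctor.obj b).property
  exact ⟨x, ⟨e ≪≫ Pseudofunctor.StrongTrans.isoAt ψ b⟩⟩

/-! ### Conjugation by adjoint equivalences and transport of pseudofunctors. -/

namespace CategoryTheory.Bicategory.Equivalence

variable {M : Type u₂} [Bicategory.{w₂, v₂} M]

/-- `conjComp` inserts an inverse counit and `conjId` an inverse unit, so the triangle identities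
are needed in inverted form. -/
lemma left_triangle_inv {a b : M} (e : a ≌ b) :
    e.hom ◁ e.counit.inv ⊗≫ e.unit.inv ▷ e.hom = (ρ_ e.hom).hom ≫ (λ_ e.hom).inv := by
  have := congr_arg Iso.inv e.left_triangle
  rw [leftZigzagIso_inv] at this
  exact this

lemma right_triangle_inv {a b : M} (e : a ≌ b) :
    e.counit.inv ▷ e.inv ⊗≫ e.inv ◁ e.unit.inv = (λ_ e.inv).hom ≫ (ρ_ e.inv).inv := by
  have := congr_arg Iso.inv e.right_triangle
  rw [rightZigzagIso_inv] at this
  exact this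

section
variable {a b c d a' b' c' d' : M} (e : a ≌ a') (f : b ≌ b') (g : c ≌ c') (h : d ≌ d')

/-- Conjugation by equivalences is compatible with composition. -/
noncomputable def conjComp (p : a' ⟶ b') (q : b' ⟶ c') :
    e.hom ≫ (p ≫ q) ≫ g.inv ≅ (e.hom ≫ p ≫ f.inv) ≫ f.hom ≫ q ≫ g.inv :=
  whiskerLeftIso e.hom (α_ _ _ _ ≪≫ whiskerLeftIso p ((λ_ _).symm ≪≫
    whiskerRightIso f.counit.symm (q ≫ g.inv) ≪≫ α_ _ _ _) ≪≫ (α_ _ _ _).symm) ≪≫ (α_ _ _ _).symm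

/-- Conjugation by an equivalence is compatible with identities. -/
noncomputable def conjId : e.hom ≫ 𝟙 a' ≫ e.inv ≅ 𝟙 a :=
  whiskerLeftIso e.hom (λ_ _) ≪≫ e.unit.symm

lemma conjComp_hom (p : a' ⟶ b') (q : b' ⟶ c') : (conjComp e f g p q).hom =
    𝟙 _ ⊗≫ (e.hom ≫ p) ◁ f.counit.inv ▷ (q ≫ g.inv) ⊗≫ 𝟙 _ := by
  simp only [conjComp, Iso.trans_hom, Bicategory.whiskerLeftIso_hom, Iso.symm_hom,
    Bicategory.whiskerRightIso_hom]
  bicategory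

lemma conjId_hom : (conjId e).hom = e.hom ◁ (λ_ _).hom ≫ e.unit.inv := rfl

lemma conjComp_naturality_left {p p' : a' ⟶ b'} (η : p ⟶ p') (q : b' ⟶ c') :
    e.hom ◁ (η ▷ q) ▷ g.inv ≫ (conjComp e f g p' q).hom =
      (conjComp e f g p q).hom ≫ (e.hom ◁ η ▷ f.inv) ▷ (f.hom ≫ q ≫ g.inv) := by
  rw [conjComp_hom, conjComp_hom]
  calc
    _ = 𝟙 _ ⊗≫ e.hom ◁ ((η ▷ 𝟙 _ ≫ p' ◁ f.counit.inv) ▷ (q ≫ g.inv)) ⊗≫ 𝟙 _ := by bicategory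
    _ = _ := by
      rw [← whisker_exchange]
      bicategory

lemma conjComp_naturality_right (p : a' ⟶ b') {q q' : b' ⟶ c'} (η : q ⟶ q') :
    e.hom ◁ (p ◁ η) ▷ g.inv ≫ (conjComp e f g p q').hom =
      (conjComp e f g p q).hom ≫ (e.hom ≫ p ≫ f.inv) ◁ (f.hom ◁ η ▷ g.inv) := by
  rw [conjComp_hom, conjComp_hom]
  calc
    _ = 𝟙 _ ⊗≫ (e.hom ≫ p) ◁ ((𝟙 _ ◁ η ≫ f.counit.inv ▷ q') ▷ g.inv) ⊗≫ 𝟙 _ := by bicategory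
    _ = _ := by
      rw [whisker_exchange]
      bicategory

/-- The two inverse counits are inserted at different places of `p ≫ q ≫ r`, so by the interchange
law their order does not matter. -/
lemma conjComp_assoc (p : a' ⟶ b') (q : b' ⟶ c') (r : c' ⟶ d') :
    (conjComp e g h (p ≫ q) r).hom ≫ (conjComp e f g p q).hom ▷ (g.hom ≫ r ≫ h.inv) ≫
        (α_ _ _ _).hom =
      e.hom ◁ (α_ p q r).hom ▷ h.inv ≫ (conjComp e f h p (q ≫ r)).hom ≫
        (e.hom ≫ p ≫ f.inv) ◁ (conjComp f g h q r).hom := by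
  simp only [conjComp_hom]
  calc
    _ = 𝟙 _ ⊗≫ (e.hom ≫ p) ◁ (𝟙 _ ◁ (q ◁ g.counit.inv ▷ r) ≫
        f.counit.inv ▷ (q ≫ (g.inv ≫ g.hom) ≫ r)) ▷ h.inv ⊗≫ 𝟙 _ := by bicategory
    _ = _ := by
      rw [whisker_exchange]
      bicategory

/-- The inserted counit cancels against the unit by a triangle identity. This, with its right-hand
counterpart, is why transport uses adjoint equivalences. -/
lemma conjComp_leftUnitor (p : a' ⟶ b') :
    e.hom ◁ (λ_ p).hom ▷ f.inv =
      (conjComp e e f (𝟙 a') p).hom ≫ (conjId e).hom ▷ (e.hom ≫ p ≫ f.inv) ≫ (λ_ _).hom := by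
  rw [conjComp_hom, conjId_hom]
  symm
  calc
    _ = 𝟙 _ ⊗≫ (e.hom ◁ e.counit.inv ⊗≫ e.unit.inv ▷ e.hom) ▷ (p ≫ f.inv) ⊗≫ 𝟙 _ := by bicategory
    _ = _ := by
      rw [left_triangle_inv]
      bicategory

lemma conjComp_rightUnitor (p : a' ⟶ b') :
    e.hom ◁ (ρ_ p).hom ▷ f.inv =
      (conjComp e f f p (𝟙 b')).hom ≫ (e.hom ≫ p ≫ f.inv) ◁ (conjId f).hom ≫ (ρ_ _).hom := by
  rw [conjComp_hom, conjId_hom]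
  symm
  calc
    _ = 𝟙 _ ⊗≫ (e.hom ≫ p) ◁ (f.counit.inv ▷ f.inv ⊗≫ f.inv ◁ f.unit.inv) ⊗≫ 𝟙 _ := by bicategory
    _ = _ := by
      rw [right_triangle_inv]
      bicategory

end

end CategoryTheory.Bicategory.Equivalence

namespace CategoryTheory.Pseudofunctor

open Bicategory.Equivalence

variable {D : Type u₁} [Bicategory.{w₁, v₁} D] {M : Type u₂} [Bicategory.{w₂, v₂} M]

/-- Transport of a pseudofunctor along a family of adjoint equivalences. -/
noncomputable def transport (E : D ⥤ᵖ M) {obj : D → M} (e : ∀ a, obj a ≌ E.obj a) : D ⥤ᵖ M where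
  obj := obj
  map {a b} f := (e a).hom ≫ E.map f ≫ (e b).inv
  map₂ {a b _ _} η := (e a).hom ◁ E.map₂ η ▷ (e b).inv
  mapId a := whiskerLeftIso (e a).hom (whiskerRightIso (E.mapId a) (e a).inv) ≪≫ conjId (e a)
  mapComp {a b c} f g := whiskerLeftIso (e a).hom (whiskerRightIso (E.mapComp f g) (e c).inv) ≪≫
      conjComp (e a) (e b) (e c) (E.map f) (E.map g)
  map₂_whisker_left {a b c} f g h η := by
    rw [← Category.assoc, Iso.eq_comp_inv]
    simp only [Iso.trans_hom, Bicategory.whiskerLeftIso_hom, Bicategory.whiskerRightIso_hom,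
      Category.assoc, ← conjComp_naturality_right]
    simp only [← whiskerLeft_comp_assoc, ← comp_whiskerRight, map₂_whisker_left, Category.assoc,
      Iso.inv_hom_id, Category.comp_id]
  map₂_whisker_right η h := by
    rw [← Category.assoc, Iso.eq_comp_inv]
    simp only [Iso.trans_hom, Bicategory.whiskerLeftIso_hom, Bicategory.whiskerRightIso_hom,
      Category.assoc, ← conjComp_naturality_left]
    simp only [← whiskerLeft_comp_assoc, ← comp_whiskerRight, map₂_whisker_right, Category.assoc,
      Iso.inv_hom_id, Category.comp_id]
  map₂_associator f g h := by
    simp only [← whiskerLeftIso_inv]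
    simp only [← Category.assoc, Iso.eq_comp_inv]
    simp only [Iso.trans_hom, Bicategory.whiskerLeftIso_hom, Bicategory.whiskerRightIso_hom,
      Category.assoc, whiskerLeft_comp, comp_whiskerRight]
    -- Naturality slides the constraints of `E` past `conjComp`, separating the coherence of `E`
    -- from that of conjugation.
    rw [← reassoc_of% conjComp_naturality_right, ← reassoc_of% conjComp_naturality_left,
      conjComp_assoc]
    simp only [← whiskerLeft_comp_assoc, ← comp_whiskerRight, map₂_associator, Category.assoc,
      Iso.inv_hom_id_assoc, whiskerLeft_inv_hom, Category.comp_id]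
  map₂_left_unitor {a b} f := by
    simp only [Iso.trans_hom, Bicategory.whiskerLeftIso_hom, Bicategory.whiskerRightIso_hom,
      Category.assoc, comp_whiskerRight]
    rw [← reassoc_of% conjComp_naturality_left, ← conjComp_leftUnitor]
    simp only [← whiskerLeft_comp, ← comp_whiskerRight, map₂_left_unitor]
  map₂_right_unitor f := by
    simp only [Iso.trans_hom, Bicategory.whiskerLeftIso_hom, Bicategory.whiskerRightIso_hom,
      Category.assoc, whiskerLeft_comp]
    rw [← reassoc_of% conjComp_naturality_right, ← conjComp_rightUnitor]
    simp only [← whiskerLeft_comp, ← comp_whiskerRight, map₂_right_unitor]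

end CategoryTheory.Pseudofunctor

/-! ### Chains in the full image of a functor. -/

/-- A `J`-shaped diagram in the full image of a functor `F`: objects of the source of `F`, and
compatible morphisms between their images. -/
structure Chain {A : Type u₁} [Category.{v₁} A] {B : Type u₂} [Category.{v₂} B] (F : A ⥤ B)
    (J : Type) [Preorder J] where
  obj : J → A
  map {i j : J} (h : i ≤ j) : F.obj (obj i) ⟶ F.obj (obj j)
  map_id (i : J) : map (le_refl i) = 𝟙 _
  map_comp {i j k : J} (h : i ≤ j) (h' : j ≤ k) : map (h.trans h') = map h ≫ map h'

namespace Chain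

section

variable {A : Type u₁} [Category.{v₁} A] {B : Type u₂} [Category.{v₂} B] {F : A ⥤ B}
  {A' : Type u₃} [Category.{v₃} A'] {B' : Type u₄} [Category.{v₄} B'] {F' : A' ⥤ B'}
  {J J' : Type} [Preorder J] [Preorder J']

/-- A morphism of chains. -/
@[ext]
structure Hom (c c' : Chain F J) where
  app (i : J) : c.obj i ⟶ c'.obj i
  comm {i j : J} (h : i ≤ j) : c.map h ≫ F.map (app j) = F.map (app i) ≫ c'.map h

-- Components live in `A`, although the chain maps live in `B`: naturality in chains therefore only
-- tests morphisms of `A`.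
@[simps id_app comp_app]
instance : Category (Chain F J) where
  Hom := Hom
  id c := { app i := 𝟙 _, comm h := by simp }
  comp f g :=
    { app i := f.app i ≫ g.app i
      comm h := by
        rw [F.map_comp, F.map_comp, ← Category.assoc, f.comm, Category.assoc, g.comm,
          Category.assoc] }

@[ext]
lemma hom_ext {c c' : Chain F J} {f g : c ⟶ c'} (h : ∀ i, f.app i = g.app i) : f = g :=
  Hom.ext (funext h)

/-- An isomorphism of chains, given by components. -/
def isoMk {c c' : Chain F J} (app : ∀ i, c.obj i ≅ c'.obj i)
    (comm : ∀ {i j : J} (h : i ≤ j), c.map h ≫ F.map (app j).hom = F.map (app i).hom ≫ c'.map h) :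
    c ≅ c' where
  hom := { app i := (app i).hom, comm := comm }
  inv :=
    { app i := (app i).inv
      comm {i j} h := by
        rw [← cancel_epi (F.map (app i).hom), ← reassoc_of% comm h, ← F.map_comp, Iso.hom_inv_id,
          ← F.map_comp_assoc, Iso.hom_inv_id, F.map_id, F.map_id, Category.comp_id,
          Category.id_comp] }
  hom_inv_id := hom_ext fun i ↦ (app i).hom_inv_id
  inv_hom_id := hom_ext fun i ↦ (app i).inv_hom_id

lemma eqToHom_app {c c' : Chain F J} (h : c = c') (i : J) :
    (eqToHom h : c ⟶ c').app i = eqToHom (by rw [h]) := by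
  subst h
  rfl

/-- Evaluation of chains. -/
def ev (F : A ⥤ B) (i : J) : Chain F J ⥤ A where
  obj c := c.obj i
  map f := f.app i

/-- Restriction of chains along a monotone map. -/
def restr (F : A ⥤ B) (φ : J →o J') : Chain F J' ⥤ Chain F J where
  obj c :=
    { obj i := c.obj (φ i)
      map h := c.map (φ.monotone h)
      map_id i := c.map_id _
      map_comp h h' := c.map_comp _ _ }
  map f := { app i := f.app (φ i), comm h := f.comm _ }

/-- The constant chain. -/
def const (F : A ⥤ B) (J : Type) [Preorder J] : A ⥤ Chain F J where
  obj x :=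
    { obj _ := x
      map _ := 𝟙 _
      map_id _ := rfl
      map_comp _ _ := (Category.comp_id _).symm }
  map f := { app _ := f, comm _ := (Category.id_comp _).trans (Category.comp_id _).symm }

/-- The image of a chain under a square of functors commuting up to isomorphism. -/
def whisker (S : A ⥤ A') (T : B ⥤ B') (τ : ∀ x, F'.obj (S.obj x) ≅ T.obj (F.obj x))
    (nat : ∀ {x y : A} (a : x ⟶ y),
      F'.map (S.map a) ≫ (τ y).hom = (τ x).hom ≫ T.map (F.map a)) :
    Chain F J ⥤ Chain F' J where
  obj c :=
    { obj i := S.obj (c.obj i)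
      map h := (τ _).hom ≫ T.map (c.map h) ≫ (τ _).inv
      map_id i := by rw [c.map_id, T.map_id, Category.id_comp, Iso.hom_inv_id]
      map_comp h h' := by
        simp [c.map_comp h h'] }
  map f :=
    { app i := S.map (f.app i)
      comm h := by
        rw [← cancel_mono (τ _).hom]
        simp only [Category.assoc, nat, Iso.inv_hom_id_assoc, Iso.inv_hom_id, Category.comp_id,
          reassoc_of% nat, ← T.map_comp, f.comm] }

/-- The chain given by a functor to the full image. -/
def ofFunctor (G : J ⥤ InducedCategory B F.obj) : Chain F J where
  obj i := G.obj i
  map h := (G.map (homOfLE h)).hom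
  map_id i := congr_arg InducedCategory.Hom.hom (G.map_id i)
  map_comp h h' := congr_arg InducedCategory.Hom.hom (G.map_comp (homOfLE h) (homOfLE h'))

/-- The chain given by a morphism. -/
def mk₁ {x y : A} (a : F.obj x ⟶ F.obj y) : Chain F (Fin 2) :=
  ofFunctor (ComposableArrows.mk₁ (C := InducedCategory B F.obj) (X₀ := x) (X₁ := y) ⟨a⟩)

/-- The chain given by two composable morphisms. -/
def mk₂ {x y z : A} (a : F.obj x ⟶ F.obj y) (b : F.obj y ⟶ F.obj z) : Chain F (Fin 3) :=
  ofFunctor (ComposableArrows.mk₂ (C := InducedCategory B F.obj) (X₀ := x) (X₁ := y) (X₂ := z)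
    ⟨a⟩ ⟨b⟩)

/-- A morphism between chains of length two. -/
def homMk₁ {c c' : Chain F (Fin 2)} (u : c.obj 0 ⟶ c'.obj 0) (v : c.obj 1 ⟶ c'.obj 1)
    (h : c.map (Fin.zero_le 1) ≫ F.map v = F.map u ≫ c'.map (Fin.zero_le 1)) : c ⟶ c' where
  app i := match i with
    | 0 => u
    | 1 => v
  comm {i j} hij := match i, j, hij with
    | 0, 0, _ => by
      rw [c.map_id, c'.map_id, Category.id_comp, Category.comp_id]
    | 0, 1, _ => h
    | 1, 1, _ => by
      rw [c.map_id, c'.map_id, Category.id_comp, Category.comp_id]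

end

end Chain

/-! ### The pseudosimplicial object of chains, with degree zero replaced by `X`. -/

namespace CategoryTheory

/-- This is the shape of `naturality_comp` for a transformation whose constraints are identities. -/
lemma id_comp_eq_comp_id_comp_map_id {A : Type u₁} [Category.{v₁} A] {B : Type u₂}
    [Category.{v₂} B] (G : A ⥤ B) {b : B} {a : A} (f : b ⟶ G.obj a) :
    𝟙 b ≫ f = f ≫ 𝟙 (G.obj a) ≫ G.map (𝟙 a) := by
  simp

namespace Pseudofunctor

open StrongTrans

section conj

variable {D : Type u} [Bicategory.{w, v} D] {X B : D ⥤ᵖ Cat.{v', u'}} (p : X ⟶ B)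

/-- The image under `B.map f` of a morphism between values of `p`, conjugated by the naturality
constraint of `p`. -/
def conjAt {U V : D} (f : U ⟶ V) {x y : X.obj U}
    (a : (p.app U).toFunctor.obj x ⟶ (p.app U).toFunctor.obj y) :
    (p.app V).toFunctor.obj ((X.map f).toFunctor.obj x) ⟶
      (p.app V).toFunctor.obj ((X.map f).toFunctor.obj y) :=
  (natAt p f x).hom ≫ (B.map f).toFunctor.map a ≫ (natAt p f y).inv

/-- `conjAt` is how restriction acts on the maps of a chain. This lemma and the next two say that
the 2-cells and constraints of `X` are morphisms of chains. -/
lemma conjAt_map₂At {U V : D} {f g : U ⟶ V} (α : f ⟶ g) {x y : X.obj U}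
    (a : (p.app U).toFunctor.obj x ⟶ (p.app U).toFunctor.obj y) :
    conjAt p f a ≫ (p.app V).toFunctor.map (X.map₂At α y) =
      (p.app V).toFunctor.map (X.map₂At α x) ≫ conjAt p g a := by
  rw [← cancel_mono (natAt p g _).hom]
  simp only [conjAt, Category.assoc, natAt_map₂At, Iso.inv_hom_id, Category.comp_id,
    Iso.inv_hom_id_assoc, reassoc_of% natAt_map₂At, map₂At_naturality]

lemma conjAt_mapIdAt {U : D} {x y : X.obj U}
    (a : (p.app U).toFunctor.obj x ⟶ (p.app U).toFunctor.obj y) :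
    conjAt p (𝟙 U) a ≫ (p.app U).toFunctor.map (X.mapIdAt y).hom =
      (p.app U).toFunctor.map (X.mapIdAt x).hom ≫ a := by
  rw [← natAt_id, ← natAt_id]
  simp only [conjAt, Category.assoc, Iso.inv_hom_id_assoc, mapIdAt_naturality]

lemma conjAt_mapCompAt {U V W : D} (f : U ⟶ V) (g : V ⟶ W) {x y : X.obj U}
    (a : (p.app U).toFunctor.obj x ⟶ (p.app U).toFunctor.obj y) :
    conjAt p (f ≫ g) a ≫ (p.app W).toFunctor.map (X.mapCompAt f g y).hom =
      (p.app W).toFunctor.map (X.mapCompAt f g x).hom ≫ conjAt p g (conjAt p f a) := by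
  rw [← cancel_mono (natAt p g _).hom,
    ← cancel_mono ((B.map g).toFunctor.map (natAt p f y).hom)]
  simp only [conjAt, Category.assoc, ← natAt_comp, Iso.inv_hom_id_assoc, ← Functor.map_comp,
    mapCompAt_naturality, Iso.inv_hom_id, Category.comp_id]
  rw [reassoc_of% natAt_comp]
  simp only [Functor.map_comp]

end conj

variable {D : Type u} [Bicategory.{w, v} D] {X B : D ⥤ᵖ Cat.{v', max u' v'}} (p : X ⟶ B)
  (J J' : Type) [Preorder J] [Preorder J']

/-- The pseudofunctor of chains in the full image of `p`. -/
def chains : D ⥤ᵖ Cat.{v', max u' v'} :=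
  Pseudofunctor.mkOfComponents (fun U ↦ Cat.of (Chain (p.app U).toFunctor J))
    (fun f ↦ Chain.whisker (X.map f).toFunctor (B.map f).toFunctor (natAt p f)
      (natAt_naturality p f))
    (fun α ↦
      { app c := { app i := X.map₂At α (c.obj i), comm h := conjAt_map₂At p α (c.map h) }
        naturality _ _ a := Chain.hom_ext fun i ↦ map₂At_naturality X α (a.app i) })
    (fun _ ↦ NatIso.ofComponents (fun c ↦ Chain.isoMk (fun i ↦ X.mapIdAt (c.obj i))
      (fun h ↦ conjAt_mapIdAt p (c.map h)))
      (fun a ↦ Chain.hom_ext fun i ↦ mapIdAt_naturality X (a.app i)))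
    (fun f g ↦ NatIso.ofComponents (fun c ↦ Chain.isoMk (fun i ↦ X.mapCompAt f g (c.obj i))
      (fun h ↦ conjAt_mapCompAt p f g (c.map h)))
      (fun a ↦ Chain.hom_ext fun i ↦ mapCompAt_naturality X f g (a.app i)))
    (fun f _ ↦ Chain.hom_ext fun _ ↦ X.map₂At_id f _)
    (fun α β _ ↦ Chain.hom_ext fun _ ↦ X.map₂At_comp α β _)
    (fun f _ _ α _ ↦ Chain.hom_ext fun _ ↦ X.map₂At_whiskerLeft f α _)
    (fun α f _ ↦ Chain.hom_ext fun _ ↦ X.map₂At_whiskerRight α f _)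
    (fun f g h _ ↦ Chain.hom_ext fun _ ↦ X.map₂At_associator f g h _)
    (fun f _ ↦ Chain.hom_ext fun _ ↦ X.map₂At_leftUnitor f _)
    (fun f _ ↦ Chain.hom_ext fun _ ↦ X.map₂At_rightUnitor f _)

variable {J J'}

/-- Restriction of chains along a monotone map. -/
def restrChains (φ : J →o J') : chains p J' ⟶ chains p J :=
  StrongTrans.mkOfComponents (fun U ↦ Chain.restr (p.app U).toFunctor φ)
    (fun _ _ ↦ Iso.refl _)
    (fun _ _ _ _ ↦ (Category.comp_id _).trans (Category.id_comp _).symm)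
    (fun _ _ ↦ (Category.comp_id _).trans (Category.id_comp _).symm)
    (fun _ ↦ Category.id_comp _)
    (fun _ _ _ ↦ id_comp_eq_comp_id_comp_map_id _ _)

/-- Evaluation of chains. -/
def evChains (i : J) : chains p J ⟶ X :=
  StrongTrans.mkOfComponents (fun U ↦ Chain.ev (p.app U).toFunctor i)
    (fun _ _ ↦ Iso.refl _)
    (fun _ _ _ _ ↦ (Category.comp_id _).trans (Category.id_comp _).symm)
    (fun _ _ ↦ (Category.comp_id _).trans (Category.id_comp _).symm)
    (fun _ ↦ Category.id_comp _)
    (fun _ _ _ ↦ id_comp_eq_comp_id_comp_map_id _ _)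

variable (J) in
/-- The constant chains. -/
def constChains : X ⟶ chains p J :=
  StrongTrans.mkOfComponents (fun U ↦ Chain.const (p.app U).toFunctor J)
    -- Restricting a constant chain conjugates its identities by the constraint of `p`; the result
    -- is constant only after cancellation.
    (fun f x ↦ Chain.isoMk (fun _ ↦ Iso.refl ((X.map f).toFunctor.obj x)) (fun _ ↦ by
      change 𝟙 _ ≫ (p.app _).toFunctor.map (𝟙 _) = (p.app _).toFunctor.map (𝟙 _) ≫
        (natAt p f x).hom ≫ (B.map f).toFunctor.map (𝟙 _) ≫ (natAt p f x).inv
      simp only [Functor.map_id, Category.id_comp, Iso.hom_inv_id]))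
    (fun _ _ _ _ ↦ Chain.hom_ext fun _ ↦ (Category.comp_id _).trans (Category.id_comp _).symm)
    (fun _ _ ↦ Chain.hom_ext fun _ ↦ (Category.comp_id _).trans (Category.id_comp _).symm)
    (fun _ ↦ Chain.hom_ext fun _ ↦ Category.id_comp _)
    (fun _ _ _ ↦ Chain.hom_ext fun _ ↦ id_comp_eq_comp_id_comp_map_id _ _)

/-- Chains on a one-element type are objects of `X`. -/
noncomputable def chainsEquivalence (J : Type) [Preorder J] [Unique J] : X ≌ chains p J :=
  -- Only the counit is modified to obtain the triangle identities. The unit keeps its identity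
  -- components, on which `homAt_kernel_mapId` relies.
  Bicategory.Equivalence.mkOfAdjointifyCounit (f := constChains p J) (g := evChains p default)
    (isoOfComponents (fun U x ↦ Iso.refl x)
      (fun U _ _ a ↦ (Category.comp_id _).trans (Category.id_comp _).symm)
      (fun f x ↦ by
        rw [natAt_comp_trans, natAt_id_trans]
        exact (Category.id_comp _).trans ((Category.comp_id _).trans
          ((Category.id_comp _).trans (Functor.map_id _ _)).symm)))
    (isoOfComponents (fun U c ↦ Chain.isoMk
        (fun i ↦ eqToIso (congr_arg (Chain.obj c) (Unique.default_eq i))) (by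
          intro i j h
          obtain rfl := Unique.eq_default i
          obtain rfl := Unique.eq_default j
          change 𝟙 _ ≫ (p.app U).toFunctor.map (𝟙 _) = (p.app U).toFunctor.map (𝟙 _) ≫ c.map h
          rw [Functor.map_id, Category.id_comp, Category.id_comp]
          exact (c.map_id _).symm))
      (fun U _ _ a ↦ Chain.hom_ext fun i ↦ by
        obtain rfl := Unique.eq_default i
        exact (Category.comp_id _).trans (Category.id_comp _).symm)
      (fun f x ↦ by
        rw [natAt_comp_trans, natAt_id_trans]
        refine Chain.hom_ext fun i ↦ ?_
        obtain rfl := Unique.eq_default i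
        exact (Category.id_comp _).trans ((congr_arg (fun t ↦ t ≫ (X.map f).toFunctor.map (𝟙 _))
          (Category.comp_id _)).trans ((Category.id_comp _).trans (Functor.map_id _ _))).symm))

/-- The pseudosimplicial object of chains in the full image of `p`. -/
def simplicialChains : LocallyDiscrete SimplexCategoryᵒᵖ ⥤ᵖ (D ⥤ᵖ Cat.{v', max u' v'}) :=
  LocallyDiscrete.mkPseudofunctor (fun n ↦ chains p (Fin (n.unop.len + 1)))
    (fun φ ↦ restrChains p φ.unop.toOrderHom)
    (fun n ↦ isoOfComponents (fun U c ↦ Iso.refl c)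
      (fun _ _ _ _ ↦ (Category.comp_id _).trans (Category.id_comp _).symm)
      (fun f x ↦ by
        rw [natAt_id_trans]
        exact (Category.id_comp _).trans ((Category.id_comp _).trans (Functor.map_id _ _)).symm))
    (fun φ ψ ↦ isoOfComponents (fun U c ↦ Iso.refl _)
      (fun _ _ _ _ ↦ (Category.comp_id _).trans (Category.id_comp _).symm)
      (fun f x ↦ by
        rw [natAt_comp_trans]
        refine Chain.hom_ext fun i ↦ ?_
        exact ((Category.id_comp _).trans (Category.comp_id _)).trans
          ((Category.id_comp _).trans ((X.map f).toFunctor.map_id _)).symm))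
    (fun f g h ↦ hom_ext_at fun U c ↦ Chain.hom_ext fun i ↦ by
      rw [homAt_eqToHom]
      refine Eq.trans ?_ (Eq.symm (Chain.eqToHom_app (F := (p.app U).toFunctor) rfl i))
      exact (Category.id_comp _).trans ((Category.id_comp _).trans ((Category.id_comp _).trans
        (Category.id_comp _))))
    (fun f ↦ hom_ext_at fun U c ↦ Chain.hom_ext fun i ↦ by
      rw [homAt_eqToHom]
      refine Eq.trans ?_ (Eq.symm (Chain.eqToHom_app (F := (p.app U).toFunctor) rfl i))
      exact (Category.id_comp _).trans (Category.id_comp _))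
    (fun f ↦ hom_ext_at fun U c ↦ Chain.hom_ext fun i ↦ by
      rw [homAt_eqToHom]
      refine Eq.trans ?_ (Eq.symm (Chain.eqToHom_app (F := (p.app U).toFunctor) rfl i))
      exact (Category.id_comp _).trans (Category.id_comp _))

/-- The levels of the codescent presentation of `p`. -/
def level (p : X ⟶ B) (n : ℕ) : D ⥤ᵖ Cat.{v', max u' v'} :=
  match n with
  | 0 => X
  | n + 1 => chains p (Fin (n + 2))

/-- The levels of the codescent presentation of `p` are pseudofunctors of chains. -/
noncomputable def levelEquivalence (n : ℕ) : level p n ≌ chains p (Fin (n + 1)) :=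
  match n with
  | 0 => chainsEquivalence p (Fin 1)
  | _ + 1 => Bicategory.Equivalence.id _

/-- A pseudosimplicial object with `X` in degree zero, and chains in the full image of `p`
in positive degrees. -/
noncomputable def kernel : PseudosimplicialObject (D ⥤ᵖ Cat.{v', max u' v'}) :=
  (simplicialChains p).transport (obj := fun n ↦ level p n.as.unop.len)
    (fun n ↦ levelEquivalence p n.as.unop.len)

end Pseudofunctor

end CategoryTheory

/-! ### The descent conditions for the kernel, evaluated at chains. -/

namespace CategoryTheory

namespace Pseudofunctor

/-- Composites of identities in an abstract category are not identities by reduction. This lemma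
peels off the factors, each closed by `rfl` or a known equality. -/
lemma comp_eq_id {A : Type u₁} [Category.{v₁} A] {x : A} {f g : x ⟶ x} (hf : f = 𝟙 x)
    (hg : g = 𝟙 x) : f ≫ g = 𝟙 x := by
  rw [hf, hg, Category.comp_id]

/-- The shape of the left side of the cocycle condition at a chain: the `𝟙` are associators, and
`i`, `j` come from simplicial identities. -/
lemma comp_id_comp_eq_comp {A : Type u₁} [Category.{v₁} A] {x y z : A} (f : x ⟶ y) (g : y ⟶ z)
    {i : y ⟶ y} {j : z ⟶ z} (hi : i = 𝟙 y) (hj : j = 𝟙 z) :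
    f ≫ 𝟙 y ≫ i ≫ 𝟙 y ≫ g ≫ 𝟙 z ≫ j ≫ 𝟙 z = f ≫ g := by
  simp [hi, hj]

lemma id_comp_eq_comp_id_map {A : Type u₁} [Category.{v₁} A] {B : Type u₂} [Category.{v₂} B]
    (G : A ⥤ B) {x y : A} (f : G.obj x ⟶ G.obj y) : f ≫ G.map (𝟙 y) = G.map (𝟙 x) ≫ f := by
  simp

lemma id_comp_eq_self {A : Type u₁} [Category.{v₁} A] {x y : A} (f : x ⟶ y) {i : x ⟶ x}
    (hi : i = 𝟙 x) : 𝟙 x ≫ i ≫ 𝟙 x ≫ f = f := by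
  simp [hi]

open StrongTrans

variable {D : Type u} [Bicategory.{w, v} D] {X B Y : D ⥤ᵖ Cat.{v', max u' v'}} (p : X ⟶ B)

lemma homAt_inv_eq_eqToHom {η θ : X ⟶ Y} (Γ : η ≅ θ) {U : D} (x : X.obj U)
    (h : (η.app U).toFunctor.obj x = (θ.app U).toFunctor.obj x)
    (h' : homAt Γ.hom x = eqToHom h) : homAt Γ.inv x = eqToHom h.symm := by
  have := (isoAt Γ x).hom_inv_id
  rw [isoAt_hom, isoAt_inv, h'] at this
  rw [← cancel_epi (eqToHom h), this, eqToHom_trans, eqToHom_refl]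

lemma homAt_kernel_mapId {U : D} (x : X.obj U) :
    homAt (F := X) (G := X) ((kernel p).mapId ⟨op ⦋0⦌⟩).hom x = 𝟙 x :=
  comp_eq_id rfl (comp_eq_id rfl rfl)

/-- The middle degree is positive, so the equivalence whose counit `conjComp` inserts is an
identity. All composites in the descent conditions factor through such a degree. -/
lemma homAt_kernel_mapComp {n m : ℕ}
    (φ : LocallyDiscrete.mk (op ⦋n⦌) ⟶ LocallyDiscrete.mk (op ⦋m + 1⦌))
    (ψ : LocallyDiscrete.mk (op ⦋m + 1⦌) ⟶ LocallyDiscrete.mk (op ⦋0⦌)) {U : D}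
    (c : (level p n).obj U) :
    homAt (F := level p n) (G := X) ((kernel p).mapComp φ ψ).hom c = 𝟙 _ :=
  comp_eq_id rfl (comp_eq_id (comp_eq_id rfl
    (comp_eq_id (comp_eq_id rfl (comp_eq_id rfl rfl)) rfl)) rfl)

lemma homAt_kernel_mapComp'_hom {n m : ℕ}
    {φ : LocallyDiscrete.mk (op ⦋n⦌) ⟶ LocallyDiscrete.mk (op ⦋m + 1⦌)}
    {ψ : LocallyDiscrete.mk (op ⦋m + 1⦌) ⟶ LocallyDiscrete.mk (op ⦋0⦌)}
    {χ : LocallyDiscrete.mk (op ⦋n⦌) ⟶ LocallyDiscrete.mk (op ⦋0⦌)} (h : φ ≫ ψ = χ) {U : D}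
    (c : (level p n).obj U) :
    homAt (F := level p n) (G := X) ((kernel p).mapComp' φ ψ χ h).hom c =
      eqToHom (by subst h; rfl) := by
  subst h
  rw [mapComp'_eq_mapComp]
  exact homAt_kernel_mapComp p φ ψ c

lemma homAt_kernel_mapComp'_inv {n m : ℕ}
    {φ : LocallyDiscrete.mk (op ⦋n⦌) ⟶ LocallyDiscrete.mk (op ⦋m + 1⦌)}
    {ψ : LocallyDiscrete.mk (op ⦋m + 1⦌) ⟶ LocallyDiscrete.mk (op ⦋0⦌)}
    {χ : LocallyDiscrete.mk (op ⦋n⦌) ⟶ LocallyDiscrete.mk (op ⦋0⦌)} (h : φ ≫ ψ = χ) {U : D}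
    (c : (level p n).obj U) :
    homAt (F := level p n) (G := X) ((kernel p).mapComp' φ ψ χ h).inv c =
      eqToHom (by subst h; rfl) :=
  homAt_inv_eq_eqToHom (X := level p n) (Y := X) ((kernel p).mapComp' φ ψ χ h) c _
    (homAt_kernel_mapComp'_hom p h c)

lemma homAt_kernel_square {n m m' : ℕ}
    (φ : LocallyDiscrete.mk (op ⦋n⦌) ⟶ LocallyDiscrete.mk (op ⦋m + 1⦌))
    (ψ : LocallyDiscrete.mk (op ⦋m + 1⦌) ⟶ LocallyDiscrete.mk (op ⦋0⦌))
    (φ' : LocallyDiscrete.mk (op ⦋n⦌) ⟶ LocallyDiscrete.mk (op ⦋m' + 1⦌))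
    (ψ' : LocallyDiscrete.mk (op ⦋m' + 1⦌) ⟶ LocallyDiscrete.mk (op ⦋0⦌))
    (h : φ ≫ ψ = φ' ≫ ψ') {U : D} (c : (level p n).obj U) :
    homAt (F := level p n) (G := X) ((kernel p).square φ ψ φ' ψ' h).hom c =
      eqToHom (congr_arg (fun χ : LocallyDiscrete.mk (op ⦋n⦌) ⟶ LocallyDiscrete.mk (op ⦋0⦌) ↦
        (((kernel p).map χ).app U).toFunctor.obj c) h) :=
  (congr_arg₂ (· ≫ ·) (homAt_kernel_mapComp'_inv p h c)
    (homAt_kernel_mapComp p φ' ψ' c)).trans (Category.comp_id _)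

/-- The value of a 2-cell out of the domain of the kernel at a chain. -/
noncomputable def cellAt {g : X ⟶ Y}
    (γ : (kernel p).d (n := 0) 1 ≫ g ⟶ (kernel p).d (n := 0) 0 ≫ g) {U : D}
    (c : Chain (p.app U).toFunctor (Fin 2)) :
    (g.app U).toFunctor.obj (c.obj 0) ⟶ (g.app U).toFunctor.obj (c.obj 1) :=
  homAt γ c

/-- The transported face is an identity, then a restriction, then an evaluation of chains; each has
identity constraints. -/
lemma natAt_kernel_d (i : Fin 2) {U V : D} (f : U ⟶ V)
    (c : Chain (p.app U).toFunctor (Fin 2)) :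
    (natAt (F := chains p (Fin 2)) (G := X) ((kernel p).d (n := 0) i) f c).hom = 𝟙 _ := by
  refine (natAt_comp_trans (F := chains p (Fin 2)) (G := chains p (Fin 2)) (H := X)
    (𝟙 _) _ f c).trans ?_
  refine comp_eq_id ((congr_arg _ (natAt_id_trans (F := chains p (Fin 2)) f c)).trans
    (Functor.map_id _ _)) ?_
  exact (natAt_comp_trans (F := chains p (Fin 2)) (G := chains p (Fin 1)) (H := X) _ _ f c).trans
    (comp_eq_id rfl rfl)

lemma natAt_kernel_d_comp (g : X ⟶ Y) (i : Fin 2) {U V : D} (f : U ⟶ V)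
    (c : Chain (p.app U).toFunctor (Fin 2)) :
    (natAt (F := chains p (Fin 2)) ((kernel p).d (n := 0) i ≫ g) f c).hom =
      (natAt g f ((((kernel p).d (n := 0) i).app U).toFunctor.obj c)).hom := by
  refine (natAt_comp_trans (F := chains p (Fin 2)) (G := X) _ g f c).trans ?_
  exact (congr_arg (· ≫ _) ((congr_arg _ (natAt_kernel_d p i f c)).trans
    (Functor.map_id _ _))).trans (Category.id_comp _)

/-- A 2-cell out of the domain of the kernel, given by its values at chains. -/
noncomputable def cellMk (g : X ⟶ Y) (app : ∀ (U : D) (c : Chain (p.app U).toFunctor (Fin 2)),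
      (g.app U).toFunctor.obj (c.obj 0) ⟶ (g.app U).toFunctor.obj (c.obj 1))
    (nat : ∀ (U : D) {c c' : Chain (p.app U).toFunctor (Fin 2)} (a : c ⟶ c'),
      (g.app U).toFunctor.map (a.app 0) ≫ app U c' = app U c ≫ (g.app U).toFunctor.map (a.app 1))
    (mod : ∀ {U V : D} (f : U ⟶ V) (c : Chain (p.app U).toFunctor (Fin 2)),
      app V (((chains p (Fin 2)).map f).toFunctor.obj c) ≫ (natAt g f (c.obj 1)).hom =
        (natAt g f (c.obj 0)).hom ≫ (Y.map f).toFunctor.map (app U c)) :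
    (kernel p).d (n := 0) 1 ≫ g ⟶ (kernel p).d (n := 0) 0 ≫ g :=
  homOfComponents (F := chains p (Fin 2)) app nat fun f c ↦
    (congr_arg (app _ _ ≫ ·) (natAt_kernel_d_comp p g 0 f c)).trans ((mod f c).trans
      (congr_arg (· ≫ _) (natAt_kernel_d_comp p g 1 f c).symm))

variable {p}

lemma cellAt_naturality {g : X ⟶ Y}
    (γ : (kernel p).d (n := 0) 1 ≫ g ⟶ (kernel p).d (n := 0) 0 ≫ g) {U : D}
    {c c' : Chain (p.app U).toFunctor (Fin 2)} (a : c ⟶ c') :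
    (g.app U).toFunctor.map (a.app 0) ≫ cellAt p γ c' =
      cellAt p γ c ≫ (g.app U).toFunctor.map (a.app 1) :=
  homAt_naturality (F := chains p (Fin 2)) γ a

lemma cellAt_natAt {g : X ⟶ Y}
    (γ : (kernel p).d (n := 0) 1 ≫ g ⟶ (kernel p).d (n := 0) 0 ≫ g) {U V : D} (f : U ⟶ V)
    (c : Chain (p.app U).toFunctor (Fin 2)) :
    cellAt p γ (((chains p (Fin 2)).map f).toFunctor.obj c) ≫ (natAt g f (c.obj 1)).hom =
      (natAt g f (c.obj 0)).hom ≫ (Y.map f).toFunctor.map (cellAt p γ c) :=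
  (congr_arg (cellAt p γ _ ≫ ·) (natAt_kernel_d_comp p g 0 f c).symm).trans
    ((homAt_natAt (F := chains p (Fin 2)) γ f c).trans
      (congr_arg (· ≫ _) (natAt_kernel_d_comp p g 1 f c)))

/-- All structural 2-cells have identity values, and the degeneracy sends an object to its constant
chain. -/
lemma unit_iff {g : X ⟶ Y} (γ : (kernel p).d (n := 0) 1 ≫ g ⟶ (kernel p).d (n := 0) 0 ≫ g) :
    ((kernel p).i₀ ◁ γ = (α_ _ _ _).inv ≫ (kernel p).id₁.hom ▷ g ≫ (kernel p).id₀.inv ▷ g ≫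
      (α_ _ _ _).hom) ↔ ∀ (U : D) (x : X.obj U),
        cellAt p γ ((Chain.const (p.app U).toFunctor (Fin 2)).obj x) =
          𝟙 ((g.app U).toFunctor.obj x) := by
  have key (U : D) (x : X.obj U) :
      homAt (F := X) ((α_ _ _ _).inv ≫ (kernel p).id₁.hom ▷ g ≫ (kernel p).id₀.inv ▷ g ≫
        (α_ _ _ _).hom) x = 𝟙 ((g.app U).toFunctor.obj x) := by
    refine comp_eq_id rfl (comp_eq_id ?_ (comp_eq_id ?_ rfl))
    · refine Eq.trans (congr_arg (g.app U).toFunctor.map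
        (?_ : homAt (F := X) (G := X) (kernel p).id₁.hom x = 𝟙 x)) (Functor.map_id _ x)
      exact comp_eq_id (homAt_kernel_mapComp'_inv p (n := 0) (m := 0)
        (congrArg (fun f => f.op.toLoc) (SimplexCategory.δ_comp_σ_succ (n := 0) (i := 0))) x)
        (homAt_kernel_mapId p x)
    · refine Eq.trans (congr_arg (g.app U).toFunctor.map
        (?_ : homAt (F := X) (G := X) (kernel p).id₀.inv x = 𝟙 x)) (Functor.map_id _ x)
      refine homAt_inv_eq_eqToHom (X := X) (Y := X) (kernel p).id₀ x rfl ?_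
      exact comp_eq_id (homAt_kernel_mapComp'_inv p (n := 0) (m := 0)
        (congrArg (fun f => f.op.toLoc) (SimplexCategory.δ_comp_σ_self (n := 0) (i := 0))) x)
        (homAt_kernel_mapId p x)
  refine ⟨fun h U x ↦ (congr_arg (fun t ↦ homAt (F := X) t x) h).trans (key U x), fun h ↦ ?_⟩
  exact hom_ext_at (F := X) fun U x ↦ (h U x).trans (key U x).symm

/-- Both composite faces select the same vertex definitionally, so the `eqToHom` of
`homAt_kernel_square` is an identity. The same holds for the other two squares. -/
lemma homAt_kernel_dd₂₀ {U : D} (c : Chain (p.app U).toFunctor (Fin 3)) :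
    homAt (F := chains p (Fin 3)) (G := X) (kernel p).dd₂₀.hom c = 𝟙 (c.obj 1) :=
  homAt_kernel_square p (n := 2) (m := 0) (m' := 0) (SimplexCategory.δ 2).op.toLoc
    (SimplexCategory.δ 0).op.toLoc (SimplexCategory.δ 0).op.toLoc
    (SimplexCategory.δ 1).op.toLoc (congrArg (fun f => f.op.toLoc)
      (SimplexCategory.δ_comp_δ (n := 0) (i := 0) (j := 1) (Fin.zero_le _))) c

lemma homAt_kernel_dd₀₀ {U : D} (c : Chain (p.app U).toFunctor (Fin 3)) :
    homAt (F := chains p (Fin 3)) (G := X) (kernel p).dd₀₀.hom c = 𝟙 (c.obj 2) :=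
  homAt_kernel_square p (n := 2) (m := 0) (m' := 0) (SimplexCategory.δ 0).op.toLoc
    (SimplexCategory.δ 0).op.toLoc (SimplexCategory.δ 1).op.toLoc
    (SimplexCategory.δ 0).op.toLoc (congrArg (fun f => f.op.toLoc)
      (SimplexCategory.δ_comp_δ (n := 0) (i := 0) (j := 0) le_rfl).symm) c

lemma homAt_kernel_dd₂₁ {U : D} (c : Chain (p.app U).toFunctor (Fin 3)) :
    homAt (F := chains p (Fin 3)) (G := X) (kernel p).dd₂₁.hom c = 𝟙 (c.obj 0) :=
  homAt_kernel_square p (n := 2) (m := 0) (m' := 0) (SimplexCategory.δ 2).op.toLoc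
    (SimplexCategory.δ 1).op.toLoc (SimplexCategory.δ 1).op.toLoc
    (SimplexCategory.δ 1).op.toLoc (congrArg (fun f => f.op.toLoc)
      (SimplexCategory.δ_comp_δ (n := 0) (i := 1) (j := 1) le_rfl)) c

/-- The faces `δ 2`, `δ 0`, `δ 1` select the edges 01, 12, 02; everything else in the condition
evaluates to an identity. -/
lemma cocycle_iff {g : X ⟶ Y}
    (γ : (kernel p).d (n := 0) 1 ≫ g ⟶ (kernel p).d (n := 0) 0 ≫ g) :
    ((kernel p).d (n := 1) 2 ◁ γ ≫ (α_ _ _ _).inv ≫ (kernel p).dd₂₀.hom ▷ g ≫ (α_ _ _ _).hom ≫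
        (kernel p).d (n := 1) 0 ◁ γ ≫ (α_ _ _ _).inv ≫ (kernel p).dd₀₀.hom ▷ g ≫
          (α_ _ _ _).hom =
      (α_ _ _ _).inv ≫ (kernel p).dd₂₁.hom ▷ g ≫ (α_ _ _ _).hom ≫ (kernel p).d (n := 1) 1 ◁ γ) ↔
      ∀ (U : D) (c : Chain (p.app U).toFunctor (Fin 3)),
        (cellAt p γ ((Chain.restr _ (SimplexCategory.δ 2).toOrderHom).obj c) :
            (g.app U).toFunctor.obj (c.obj 0) ⟶ (g.app U).toFunctor.obj (c.obj 1)) ≫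
          (cellAt p γ ((Chain.restr _ (SimplexCategory.δ 0).toOrderHom).obj c) :
            (g.app U).toFunctor.obj (c.obj 1) ⟶ (g.app U).toFunctor.obj (c.obj 2)) =
        (cellAt p γ ((Chain.restr _ (SimplexCategory.δ 1).toOrderHom).obj c) :
            (g.app U).toFunctor.obj (c.obj 0) ⟶ (g.app U).toFunctor.obj (c.obj 2)) := by
  have h₂₀ (U : D) (c : Chain (p.app U).toFunctor (Fin 3)) :
      homAt (F := chains p (Fin 3)) ((kernel p).dd₂₀.hom ▷ g) c =
        𝟙 ((g.app U).toFunctor.obj (c.obj 1)) :=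
    (congr_arg (g.app U).toFunctor.map (homAt_kernel_dd₂₀ c)).trans
      (Functor.map_id _ (c.obj 1))
  have h₀₀ (U : D) (c : Chain (p.app U).toFunctor (Fin 3)) :
      homAt (F := chains p (Fin 3)) ((kernel p).dd₀₀.hom ▷ g) c =
        𝟙 ((g.app U).toFunctor.obj (c.obj 2)) :=
    (congr_arg (g.app U).toFunctor.map (homAt_kernel_dd₀₀ c)).trans
      (Functor.map_id _ (c.obj 2))
  have h₂₁ (U : D) (c : Chain (p.app U).toFunctor (Fin 3)) :
      homAt (F := chains p (Fin 3)) ((kernel p).dd₂₁.hom ▷ g) c =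
        𝟙 ((g.app U).toFunctor.obj (c.obj 0)) :=
    (congr_arg (g.app U).toFunctor.map (homAt_kernel_dd₂₁ c)).trans
      (Functor.map_id _ (c.obj 0))
  have hl (U : D) (c : Chain (p.app U).toFunctor (Fin 3)) :=
    comp_id_comp_eq_comp
      (cellAt p γ ((Chain.restr _ (SimplexCategory.δ 2).toOrderHom).obj c) :
            (g.app U).toFunctor.obj (c.obj 0) ⟶ (g.app U).toFunctor.obj (c.obj 1))
      (cellAt p γ ((Chain.restr _ (SimplexCategory.δ 0).toOrderHom).obj c) :
            (g.app U).toFunctor.obj (c.obj 1) ⟶ (g.app U).toFunctor.obj (c.obj 2))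
      (h₂₀ U c) (h₀₀ U c)
  have hr (U : D) (c : Chain (p.app U).toFunctor (Fin 3)) :=
    id_comp_eq_self
      (cellAt p γ ((Chain.restr _ (SimplexCategory.δ 1).toOrderHom).obj c) :
            (g.app U).toFunctor.obj (c.obj 0) ⟶ (g.app U).toFunctor.obj (c.obj 2)) (h₂₁ U c)
  refine ⟨fun h U c ↦ (hl U c).symm.trans
    ((congr_arg (fun t ↦ homAt (F := chains p (Fin 3)) t c) h).trans (hr U c)), fun h ↦ ?_⟩
  exact hom_ext_at (F := chains p (Fin 3)) fun U c ↦ (hl U c).trans ((h U c).trans (hr U c).symm)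

end Pseudofunctor

end CategoryTheory

/-! ### Descent data as actions of the full image. -/

namespace CategoryTheory

namespace Pseudofunctor

open StrongTrans PseudosimplicialObject

variable {D : Type u} [Bicategory.{w, v} D] {X B Y : D ⥤ᵖ Cat.{v', max u' v'}}

/-- The tautological descent datum on the target of `p`. -/
noncomputable def kernelDatum (p : X ⟶ B) : (kernel p).DescentDatum B where
  g := p
  γ := cellMk p p (fun _ c ↦ c.map (Fin.zero_le 1)) (fun _ _ _ a ↦ (a.comm _).symm)
    (fun f c ↦ (Category.assoc _ _ _).trans (congr_arg ((natAt p f _).hom ≫ ·)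
      ((Category.assoc _ _ _).trans ((congr_arg (_ ≫ ·) (Iso.inv_hom_id _)).trans
        (Category.comp_id _)))))
  unit := (unit_iff _).2 fun _ _ ↦ rfl
  cocycle := (cocycle_iff _).2 fun _ c ↦
    (c.map_comp (i := 0) (j := 1) (k := 2) (by decide) (by decide)).symm

variable {p : X ⟶ B}

/-- The action of a descent datum on the full image of `p`. -/
noncomputable def act (t : (kernel p).DescentDatum Y) {U : D} {x y : X.obj U}
    (a : (p.app U).toFunctor.obj x ⟶ (p.app U).toFunctor.obj y) :
    (StrongTrans.app (F := X) t.g U).toFunctor.obj x ⟶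
      (StrongTrans.app (F := X) t.g U).toFunctor.obj y :=
  cellAt p t.γ (Chain.mk₁ a)

section

variable (t : (kernel p).DescentDatum Y)

/-- The underlying morphism of a descent datum for the kernel. -/
abbrev underlying : X ⟶ Y := t.g

/-- Such a square is a morphism of two-vertex chains, along which `γ` is natural. -/
lemma act_naturality {U : D} {x y x' y' : X.obj U}
    {a : (p.app U).toFunctor.obj x ⟶ (p.app U).toFunctor.obj y}
    {a' : (p.app U).toFunctor.obj x' ⟶ (p.app U).toFunctor.obj y'} {i : x ⟶ x'} {j : y ⟶ y'}
    (h : a ≫ (p.app U).toFunctor.map j = (p.app U).toFunctor.map i ≫ a') :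
    ((underlying t).app U).toFunctor.map i ≫ act t a' =
      act t a ≫ ((underlying t).app U).toFunctor.map j :=
  cellAt_naturality t.γ (Chain.homMk₁ (c := Chain.mk₁ a) (c' := Chain.mk₁ a') i j h)

/-- The chain `c` and the one rebuilt from its edge need not agree definitionally, but identities
form a morphism between them; naturality of `γ` along it suffices. -/
lemma cellAt_eq_act {U : D} (c : Chain (p.app U).toFunctor (Fin 2)) :
    cellAt p t.γ c = act t (c.map (Fin.zero_le 1)) := by
  have := cellAt_naturality t.γ (Chain.homMk₁ (c := c) (c' := Chain.mk₁ (c.map (Fin.zero_le 1)))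
    (𝟙 (c.obj 0)) (𝟙 (c.obj 1)) (id_comp_eq_comp_id_map _ _))
  exact ((Category.comp_id _).symm.trans (congr_arg (_ ≫ ·) (Functor.map_id _ _).symm)).trans
    (this.symm.trans ((congr_arg (· ≫ _) (Functor.map_id _ _)).trans (Category.id_comp _)))

@[simp]
lemma act_id {U : D} (x : X.obj U) : act t (𝟙 ((p.app U).toFunctor.obj x)) = 𝟙 _ :=
  (cellAt_eq_act t _).symm.trans ((unit_iff t.γ).1 t.unit U x)

lemma act_comp {U : D} {x y z : X.obj U}
    (a : (p.app U).toFunctor.obj x ⟶ (p.app U).toFunctor.obj y)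
    (b : (p.app U).toFunctor.obj y ⟶ (p.app U).toFunctor.obj z) :
    act t (a ≫ b) = act t a ≫ act t b :=
  (cellAt_eq_act t _).symm.trans (((cocycle_iff t.γ).1 t.cocycle U (Chain.mk₂ a b)).symm.trans
    (congr_arg₂ (· ≫ ·) (cellAt_eq_act t _) (cellAt_eq_act t _)))

/-- Naturality for the square from `𝟙 (p x)` to `p i`, with sides `𝟙 x` and `i`, reduces this to the
unit condition. -/
lemma act_map {U : D} {x y : X.obj U} (i : x ⟶ y) :
    act t ((p.app U).toFunctor.map i) = ((underlying t).app U).toFunctor.map i := by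
  have := act_naturality t (a := 𝟙 ((p.app U).toFunctor.obj x))
    (a' := (p.app U).toFunctor.map i) (i := 𝟙 x) (j := i) (by simp)
  rwa [Functor.map_id, Category.id_comp, act_id, Category.id_comp] at this

/-- This is the modification axiom of `γ` at the chain of `a`, whose restriction along `f` has edge
`conjAt p f a`. -/
lemma act_conjAt {U V : D} (f : U ⟶ V) {x y : X.obj U}
    (a : (p.app U).toFunctor.obj x ⟶ (p.app U).toFunctor.obj y) :
    act t (conjAt p f a) ≫ (natAt (underlying t) f y).hom =
      (natAt (underlying t) f x).hom ≫ (Y.map f).toFunctor.map (act t a) :=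
  (congr_arg (· ≫ _) (cellAt_eq_act t _).symm).trans (cellAt_natAt t.γ f (Chain.mk₁ a))

end

lemma act_push (h : B ⟶ Y) {U : D} {x y : X.obj U}
    (a : (p.app U).toFunctor.obj x ⟶ (p.app U).toFunctor.obj y) :
    act ((kernelDatum p).push h) a = (h.app U).toFunctor.map a :=
  (Category.id_comp _).trans (Category.comp_id _)

/-- The components of a morphism of descent data. -/
abbrev underlyingHom {t t' : (kernel p).DescentDatum Y} (w : t ⟶ t') :
    underlying t ⟶ underlying t' :=
  w.u

lemma act_homAt {t t' : (kernel p).DescentDatum Y} (w : t ⟶ t') {U : D} {x y : X.obj U}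
    (a : (p.app U).toFunctor.obj x ⟶ (p.app U).toFunctor.obj y) :
    act t a ≫ homAt (underlyingHom w) y = homAt (underlyingHom w) x ≫ act t' a :=
  congr_arg (fun Γ ↦ homAt (F := chains p (Fin 2)) Γ (Chain.mk₁ a)) w.comm

lemma hom_comm_of_act {t t' : (kernel p).DescentDatum Y} (w : underlying t ⟶ underlying t')
    (h : ∀ {U : D} {x y : X.obj U} (a : (p.app U).toFunctor.obj x ⟶ (p.app U).toFunctor.obj y),
      act t a ≫ homAt w y = homAt w x ≫ act t' a) :
    t.γ ≫ (kernel p).d (n := 0) 0 ◁ w = (kernel p).d (n := 0) 1 ◁ w ≫ t'.γ :=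
  hom_ext_at (F := chains p (Fin 2)) fun _ c ↦
    (congr_arg (· ≫ _) (cellAt_eq_act t c)).trans ((h _).trans
      (congr_arg (_ ≫ ·) (cellAt_eq_act t' c).symm))

end Pseudofunctor

end CategoryTheory

/-! ### Extending transformations from the full image to `B`. -/

namespace CategoryTheory

namespace Pseudofunctor

lemma comp_comp_inv_comp_hom {A : Type u₁} [Category.{v₁} A] {x y z z' : A} (f : x ⟶ y)
    (g : y ⟶ z) (e : z' ≅ z) : (f ≫ g ≫ e.inv) ≫ e.hom = f ≫ g := by
  simp

open StrongTrans

variable {D : Type u} [Bicategory.{w, v} D] {X B Y : D ⥤ᵖ Cat.{v', u'}}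

/-- An extension of a transformation `g : X ⟶ Y` to the full image of `p : X ⟶ B`. -/
structure ImageExtension (p : X ⟶ B) (Y : D ⥤ᵖ Cat.{v', u'}) where
  g : X ⟶ Y
  act {U : D} {x y : X.obj U} (a : (p.app U).toFunctor.obj x ⟶ (p.app U).toFunctor.obj y) :
    (g.app U).toFunctor.obj x ⟶ (g.app U).toFunctor.obj y
  act_id {U : D} (x : X.obj U) : act (𝟙 ((p.app U).toFunctor.obj x)) = 𝟙 _
  act_comp {U : D} {x y z : X.obj U}
    (a : (p.app U).toFunctor.obj x ⟶ (p.app U).toFunctor.obj y)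
    (b : (p.app U).toFunctor.obj y ⟶ (p.app U).toFunctor.obj z) :
    act (a ≫ b) = act a ≫ act b
  act_map {U : D} {x y : X.obj U} (i : x ⟶ y) :
    act ((p.app U).toFunctor.map i) = (g.app U).toFunctor.map i
  act_conjAt {U V : D} (f : U ⟶ V) {x y : X.obj U}
    (a : (p.app U).toFunctor.obj x ⟶ (p.app U).toFunctor.obj y) :
    act (conjAt p f a) ≫ (natAt g f y).hom = (natAt g f x).hom ≫ (Y.map f).toFunctor.map (act a)

namespace ImageExtension

variable {p : X ⟶ B} (t : ImageExtension p Y)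

lemma act_comp_assoc {U : D} {x y z : X.obj U}
    (a : (p.app U).toFunctor.obj x ⟶ (p.app U).toFunctor.obj y)
    (b : (p.app U).toFunctor.obj y ⟶ (p.app U).toFunctor.obj z) {w : Y.obj U}
    (c : (t.g.app U).toFunctor.obj z ⟶ w) :
    t.act (a ≫ b) ≫ c = t.act a ≫ t.act b ≫ c := by
  rw [act_comp, Category.assoc]

/-- The action of an extension on isomorphisms. -/
@[simps]
def actIso {U : D} {x y : X.obj U}
    (a : (p.app U).toFunctor.obj x ≅ (p.app U).toFunctor.obj y) :
    (t.g.app U).toFunctor.obj x ≅ (t.g.app U).toFunctor.obj y where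
  hom := t.act a.hom
  inv := t.act a.inv
  hom_inv_id := by rw [← act_comp, Iso.hom_inv_id, act_id]
  inv_hom_id := by rw [← act_comp, Iso.inv_hom_id, act_id]

variable {σ : ∀ {U : D}, B.obj U → X.obj U}
  (ξ : ∀ {U : D} (b : B.obj U), (p.app U).toFunctor.obj (σ b) ≅ b)

/-- The naturality isomorphism of `ImageExtension.lift`, before applying the action. -/
def liftNatIso {U V : D} (f : U ⟶ V) (b : B.obj U) :
    (p.app V).toFunctor.obj (σ ((B.map f).toFunctor.obj b)) ≅
      (p.app V).toFunctor.obj ((X.map f).toFunctor.obj (σ b)) :=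
  ξ ((B.map f).toFunctor.obj b) ≪≫ (B.map f).toFunctor.mapIso (ξ b).symm ≪≫ (natAt p f (σ b)).symm

lemma liftNatIso_hom {U V : D} (f : U ⟶ V) (b : B.obj U) :
    (liftNatIso (p := p) ξ f b).hom = (ξ ((B.map f).toFunctor.obj b)).hom ≫
      (B.map f).toFunctor.map (ξ b).inv ≫ (natAt p f (σ b)).inv := rfl

/-- The descent of an extension along a pointwise essentially surjective transformation. -/
def lift : B ⟶ Y :=
  StrongTrans.mkOfComponents
    (fun U ↦
      { obj b := (t.g.app U).toFunctor.obj (σ b)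
        map {b b'} β := t.act ((ξ b).hom ≫ β ≫ (ξ b').inv)
        map_id b := by rw [Category.id_comp, Iso.hom_inv_id, act_id]
        map_comp β β' := by
          rw [← act_comp]
          simp only [Category.assoc, Iso.inv_hom_id_assoc] })
    (fun f b ↦ t.actIso (liftNatIso ξ f b) ≪≫ natAt t.g f (σ b))
    (fun f b b' β ↦ by
      simp only [Iso.trans_hom, actIso_hom]
      -- Restrictions of actions become actions of conjugates, so functoriality of `act` moves the
      -- identity into `B`, where the `ξ` cancel. The remaining axioms follow the same pattern.
      rw [Category.assoc, ← t.act_conjAt, ← act_comp_assoc, ← act_comp_assoc]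
      congr 2
      simp only [liftNatIso_hom, conjAt, Category.assoc, Iso.inv_hom_id_assoc,
        ← Functor.map_comp_assoc])
    (fun {U V f f'} α b ↦ by
      simp only [Iso.trans_hom, actIso_hom]
      rw [Category.assoc, ← natAt_map₂At, ← t.act_map, ← act_comp_assoc, ← act_comp_assoc]
      congr 2
      rw [← cancel_mono (natAt p f' (σ b)).hom]
      simp only [liftNatIso_hom, Category.assoc, Iso.inv_hom_id_assoc, Iso.inv_hom_id,
        Category.comp_id, natAt_map₂At, map₂At_naturality])
    (fun {U} b ↦ by
      simp only [Iso.trans_hom, actIso_hom]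
      rw [Category.assoc, natAt_id, ← t.act_map, ← act_comp]
      congr 1
      rw [← natAt_id]
      simp only [liftNatIso_hom, Category.assoc, Iso.inv_hom_id_assoc, mapIdAt_naturality])
    (fun {U V W} f f' b ↦ by
      simp only [Iso.trans_hom, actIso_hom]
      rw [Category.assoc, natAt_comp, ← t.act_map, Functor.map_comp, Category.assoc,
        ← reassoc_of% t.act_conjAt]
      simp only [← Category.assoc, ← act_comp]
      congr 3
      rw [← cancel_mono (natAt p f' _).hom,
        ← cancel_mono ((B.map f').toFunctor.map (natAt p f _).hom)]
      simp only [liftNatIso_hom, conjAt, Category.assoc, ← natAt_comp, Iso.inv_hom_id_assoc,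
        Iso.inv_hom_id, Category.comp_id, mapCompAt_naturality,
        ← Functor.map_comp_assoc, ← Functor.map_comp])

/-- The descent of an extension extends the given transformation. -/
def compLiftIso : p ≫ t.lift ξ ≅ t.g :=
  isoOfComponents (fun U x ↦ t.actIso (ξ ((p.app U).toFunctor.obj x)))
    (fun U x y i ↦ (t.act_comp _ _).symm.trans
      ((congr_arg t.act (comp_comp_inv_comp_hom _ _ _)).trans ((t.act_comp _ _).trans
        (congr_arg (_ ≫ ·) (t.act_map i)))))
    (fun {U V} f x ↦ by
      have h : t.act (ξ ((p.app V).toFunctor.obj ((X.map f).toFunctor.obj x))).hom ≫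
          (natAt t.g f x).hom = (t.act ((ξ ((p.app V).toFunctor.obj
            ((X.map f).toFunctor.obj x))).hom ≫ (natAt p f x).hom ≫
            (ξ ((B.map f).toFunctor.obj ((p.app U).toFunctor.obj x))).inv) ≫
            t.act (liftNatIso ξ f ((p.app U).toFunctor.obj x)).hom ≫
            (natAt t.g f (σ ((p.app U).toFunctor.obj x))).hom) ≫
            (Y.map f).toFunctor.map (t.act (ξ ((p.app U).toFunctor.obj x)).hom) := by
        rw [Category.assoc, Category.assoc, ← t.act_conjAt, ← act_comp_assoc, ← act_comp_assoc]
        congr 2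
        simp only [liftNatIso_hom, conjAt, Category.assoc, Iso.inv_hom_id_assoc,
          ← Functor.map_comp_assoc, Iso.inv_hom_id, Functor.map_id, Category.id_comp,
          Iso.hom_inv_id, Category.comp_id]
      exact h.trans (congr_arg (· ≫ _) (natAt_comp_trans p (t.lift ξ) f x).symm))

/-- Compatibility with all morphisms `p x ⟶ p y`, not just those from `X`, makes `compLiftIso` an
isomorphism of descent data. -/
lemma map_comp_homAt_compLiftIso {U : D} {x y : X.obj U}
    (a : (p.app U).toFunctor.obj x ⟶ (p.app U).toFunctor.obj y) :
    ((t.lift ξ).app U).toFunctor.map a ≫ homAt (t.compLiftIso ξ).hom y =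
      homAt (t.compLiftIso ξ).hom x ≫ t.act a :=
  (t.act_comp _ _).symm.trans
    ((congr_arg t.act (comp_comp_inv_comp_hom _ _ _)).trans (t.act_comp _ _))

end ImageExtension

end Pseudofunctor

end CategoryTheory

/-! ### The comparison functor of the kernel is an equivalence. -/

namespace CategoryTheory

namespace Pseudofunctor

open StrongTrans PseudosimplicialObject

section

variable {D : Type u} [Bicategory.{w, v} D] {X B Y : D ⥤ᵖ Cat.{v', u'}} {p : X ⟶ B}

/-- Naturality along an isomorphism `p x ≅ b` determines the component at `b`. -/
lemma hom_ext_of_essSurj (hp : ∀ U, (p.app U).toFunctor.EssSurj) {h h' : B ⟶ Y} {Γ Γ' : h ⟶ h'}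
    (hΓ : ∀ (U : D) (x : X.obj U),
      homAt Γ ((p.app U).toFunctor.obj x) = homAt Γ' ((p.app U).toFunctor.obj x)) : Γ = Γ' := by
  refine hom_ext_at fun U b ↦ ?_
  obtain ⟨x, ⟨e⟩⟩ := (hp U).mem_essImage b
  rw [← cancel_epi ((h.app U).toFunctor.map e.hom), homAt_naturality, homAt_naturality, hΓ]

variable {σ : ∀ {U : D}, B.obj U → X.obj U}
  (ξ : ∀ {U : D} (b : B.obj U), (p.app U).toFunctor.obj (σ b) ≅ b)

/-- The extension of a family defined on the image of `p` to the essential image. -/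
def extendAt {h h' : B ⟶ Y} (u : ∀ {U : D} (x : X.obj U),
      (h.app U).toFunctor.obj ((p.app U).toFunctor.obj x) ⟶
        (h'.app U).toFunctor.obj ((p.app U).toFunctor.obj x)) {U : D} (b : B.obj U) :
    (h.app U).toFunctor.obj b ⟶ (h'.app U).toFunctor.obj b :=
  (h.app U).toFunctor.map (ξ b).inv ≫ u (σ b) ≫ (h'.app U).toFunctor.map (ξ b).hom

variable {h h' : B ⟶ Y} {u : ∀ {U : D} (x : X.obj U),
      (h.app U).toFunctor.obj ((p.app U).toFunctor.obj x) ⟶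
        (h'.app U).toFunctor.obj ((p.app U).toFunctor.obj x)}

/-- Since `u` is natural for every morphism of `B` between values of `p`, the extension can be
computed from any `e : p x ⟶ b`, not only from the chosen `ξ b`. -/
lemma map_comp_extendAt (hu : ∀ {U : D} {x y : X.obj U}
    (a : (p.app U).toFunctor.obj x ⟶ (p.app U).toFunctor.obj y),
    (h.app U).toFunctor.map a ≫ u y = u x ≫ (h'.app U).toFunctor.map a) {U : D} {x : X.obj U}
    {b : B.obj U} (e : (p.app U).toFunctor.obj x ⟶ b) :
    (h.app U).toFunctor.map e ≫ extendAt ξ u b = u x ≫ (h'.app U).toFunctor.map e := by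
  rw [extendAt, ← Functor.map_comp_assoc, reassoc_of% hu (e ≫ (ξ b).inv), ← Functor.map_comp,
    Category.assoc, Iso.inv_hom_id, Category.comp_id]

lemma extendAt_naturality (hu : ∀ {U : D} {x y : X.obj U}
    (a : (p.app U).toFunctor.obj x ⟶ (p.app U).toFunctor.obj y),
    (h.app U).toFunctor.map a ≫ u y = u x ≫ (h'.app U).toFunctor.map a) {U : D}
    {b b' : B.obj U} (β : b ⟶ b') :
    (h.app U).toFunctor.map β ≫ extendAt ξ u b' = extendAt ξ u b ≫ (h'.app U).toFunctor.map β := by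
  rw [← cancel_epi ((h.app U).toFunctor.map (ξ b).hom), ← Functor.map_comp_assoc,
    map_comp_extendAt ξ hu, reassoc_of% map_comp_extendAt ξ hu, Functor.map_comp]

lemma extendAt_natAt (hu : ∀ {U : D} {x y : X.obj U}
    (a : (p.app U).toFunctor.obj x ⟶ (p.app U).toFunctor.obj y),
    (h.app U).toFunctor.map a ≫ u y = u x ≫ (h'.app U).toFunctor.map a)
    (hu' : ∀ {U V : D} (f : U ⟶ V) (x : X.obj U), u ((X.map f).toFunctor.obj x) ≫
      (h'.app V).toFunctor.map (natAt p f x).hom ≫ (natAt h' f _).hom =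
        (h.app V).toFunctor.map (natAt p f x).hom ≫ (natAt h f _).hom ≫
          (Y.map f).toFunctor.map (u x)) {U V : D} (f : U ⟶ V) (b : B.obj U) :
    extendAt ξ u ((B.map f).toFunctor.obj b) ≫ (natAt h' f b).hom =
      (natAt h f b).hom ≫ (Y.map f).toFunctor.map (extendAt ξ u b) := by
  -- The test isomorphism starts at a value of `p`, where `map_comp_extendAt` replaces the extension
  -- by `u` and `hu'` applies.
  rw [← cancel_epi ((h.app V).toFunctor.map
      ((natAt p f (σ b)).hom ≫ (B.map f).toFunctor.map (ξ b).hom)),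
    reassoc_of% map_comp_extendAt ξ hu, Functor.map_comp, Functor.map_comp, Category.assoc,
    natAt_naturality, reassoc_of% hu', ← Functor.map_comp, ← map_comp_extendAt ξ hu,
    Functor.map_comp, Category.assoc, reassoc_of% natAt_naturality]

end

variable {D : Type u} [Bicategory.{w, v} D] {X B Y : D ⥤ᵖ Cat.{v', max u' v'}} {p : X ⟶ B}

/-- The extension to the full image of `p` given by a descent datum. -/
noncomputable def imageExtension (t : (kernel p).DescentDatum Y) : ImageExtension p Y where
  g := underlying t
  act := act t
  act_id := act_id t
  act_comp := act_comp t
  act_map := act_map t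
  act_conjAt := act_conjAt t

lemma kernelDatum_comparison_faithful (hp : ∀ U, (p.app U).toFunctor.EssSurj) :
    ((kernelDatum p).comparison Y).Faithful where
  map_injective h := hom_ext_of_essSurj hp fun _ x ↦
    congr_arg (fun w ↦ homAt (underlyingHom w) x) h

lemma kernelDatum_comparison_full (hp : ∀ U, (p.app U).toFunctor.EssSurj) :
    ((kernelDatum p).comparison Y).Full where
  map_surjective {h h'} w := by
    let ξ {U : D} (b : B.obj U) := (p.app U).toFunctor.objObjPreimageIso b
    let u {U : D} (x : X.obj U) : (h.app U).toFunctor.obj ((p.app U).toFunctor.obj x) ⟶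
        (h'.app U).toFunctor.obj ((p.app U).toFunctor.obj x) := homAt (underlyingHom w) x
    -- Pushed data act through `h` and `h'` themselves, so compatibility of `w` with the 2-cells is
    -- naturality for all morphisms between values of `p`.
    have hu {U : D} {x y : X.obj U}
        (a : (p.app U).toFunctor.obj x ⟶ (p.app U).toFunctor.obj y) :
        (h.app U).toFunctor.map a ≫ u y = u x ≫ (h'.app U).toFunctor.map a :=
      (congr_arg (· ≫ _) (act_push h a)).symm.trans ((act_homAt w a).trans
        (congr_arg (_ ≫ ·) (act_push h' a)))
    have hu' {U V : D} (f : U ⟶ V) (x : X.obj U) : u ((X.map f).toFunctor.obj x) ≫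
        (h'.app V).toFunctor.map (natAt p f x).hom ≫ (natAt h' f _).hom =
          (h.app V).toFunctor.map (natAt p f x).hom ≫ (natAt h f _).hom ≫
            (Y.map f).toFunctor.map (u x) :=
      (congr_arg (_ ≫ ·) (natAt_comp_trans p h' f x).symm).trans
        ((homAt_natAt (underlyingHom w) f x).trans
          ((congr_arg (· ≫ _) (natAt_comp_trans p h f x)).trans
          (Category.assoc _ _ _)))
    refine ⟨homOfComponents (fun U b ↦ extendAt ξ u b) (fun U _ _ β ↦ extendAt_naturality ξ hu β)
      (fun f b ↦ extendAt_natAt ξ hu hu' f b), DescentDatum.Hom.ext ?_⟩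
    refine hom_ext_at (F := X) fun U x ↦ ?_
    -- Taking `e` to be an identity shows that the extension restricts to `w`.
    have := map_comp_extendAt ξ hu (𝟙 ((p.app U).toFunctor.obj x))
    rw [Functor.map_id, Functor.map_id, Category.id_comp, Category.comp_id] at this
    exact this

lemma kernelDatum_comparison_essSurj (hp : ∀ U, (p.app U).toFunctor.EssSurj) :
    ((kernelDatum p).comparison Y).EssSurj where
  mem_essImage t :=
    let ξ {U : D} (b : B.obj U) := (p.app U).toFunctor.objObjPreimageIso b
    ⟨(imageExtension t).lift ξ, ⟨DescentDatum.isoMk ((imageExtension t).compLiftIso ξ)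
      (hom_comm_of_act _ fun a ↦ (congr_arg (· ≫ _) (act_push _ a)).trans
        ((imageExtension t).map_comp_homAt_compLiftIso ξ a))⟩⟩

lemma kernelDatum_comparison_isEquivalence (hp : ∀ U, (p.app U).toFunctor.EssSurj) :
    ((kernelDatum p).comparison Y).IsEquivalence where
  faithful := kernelDatum_comparison_faithful hp
  full := kernelDatum_comparison_full hp
  essSurj := kernelDatum_comparison_essSurj hp

end Pseudofunctor

end CategoryTheory

theorem proposition5p1 {C : Type uC} [Category.{vC} C] [Limits.HasFiniteLimits C]
    {X B : ParamCat.{v, u} C} (p : X ⟶ B) :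
    ParamCat.IsEso p ↔
      ∃ (E : PseudosimplicialObject (ParamCat.{v, u} C)) (h : X = E.level 0),
        E.ExhibitsCodescentObject (h ▸ p : E.level 0 ⟶ B) := by
  -- The first `rfl` holds because degree zero of the kernel was replaced by `X` itself.
  refine ⟨fun hp ↦ ⟨Pseudofunctor.kernel p, rfl, Pseudofunctor.kernelDatum p, rfl, fun Y ↦
    Pseudofunctor.kernelDatum_comparison_isEquivalence fun U ↦ hp U.as.unop⟩, ?_⟩
  rintro ⟨E, h, hE⟩
  subst h
  obtain ⟨s, rfl, hs⟩ := hE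
  exact s.isEso hs
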